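/- Let $\mathfrak h$ be a finite dimensional real linear space, $I$ a finite set, and let $(\mathfrak h,(H_i,L_i)_{i\in I})$ be a linear Coxeter system: $H_i\subseteq\mathfrak h$ and $L_i\subseteq\mathfrak h^*$ are zero-based closed rays, generated by elements $h_i$ and $\alpha_i$ with $\alpha_i(h_i)=2$, such that the cone $\overline C=\{\lambda\in\mathfrak h^*\mid\lambda(h_i)\ge 0 \text{ for all } i\in I\}$ spans $\mathfrak h^*$, its pairwise different $1$-codimensional faces are $\overline C\cap\{\lambda \mid \lambda(h_i)=0\}$, $i\in I$, and, for $C=\{\lambda\mid\lambda(h_i)>0\text{ for all }i\in I\}$ and the group $\mathcal W$ generated by the reflections $\sigma_i\lambda=\lambda-\lambda(h_i)\alpha_i$, one has $\sigma C\cap C=\emptyset$ for all $\sigma\in\mathcal W\setminus\{1\}$. Let $X=\bigcup_{\sigma\in\mathcal W}\sigma\overline C$ be the Tits cone and $A=(\alpha_j(h_i))_{i,j\in I}$ the generalized Cartan matrix. For $J\subseteq I$ let $J^\infty$ be the union of those connected components of $J$ (for the graph on $I$ in which $j\neq k$ are adjacent if $\alpha_j(h_k)\ne0$) whose submatrix of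 $A$ is not of finite type. Here a submatrix $B$ is of finite type if $\det B\neq 0$, there is $u>0$ with $Bu>0$, and $Bv\ge0$ implies $v>0$ or $v=0$ (componentwise inequalities). The set $J$ is facial if $J=\{i\in I\mid h_i\in F\}$ for some nonempty face $F$ of the convex cone $\sum_{i\in I}\mathbb R_{\ge0}h_i$, and special facial if it is facial and $J^\infty=J$. Let $Y\subseteq X$ be a $\mathcal W$-invariant convex cone with $0\in Y$, let $\mathrm{Fa}(Y)$ be the set of its nonempty faces, ordered by inclusion, and for $R\in\mathrm{Fa}(Y)$ let $\dim R$ be the dimension of its linear hull. Let $\Upsilon$ be the set of $R\in\mathrm{Fa}(Y)$ whose relative interior meets $\overline C$. For $R\in\Upsilon$ let $$\upsilon(R)=\{i\in I\mid\sigma_iR=R\},\quad \upsilon_*(R)=\{i\in I\mid\sigma_i\text{ fixes }R\text{ pointwise}\},\quad \upsilon^*(R)=\upsilon(R)\setminus\upsilon_*(R).$$ For $\Theta\subseteq I$ special facial put $\Upsilon(\Theta)=\{R\in\Upsilon\mid\upsilon_*(R)^\infty=\Theta\}$ and $\mathrm{Fa}(Y)_\Theta=\{\sigma R\mid\sigma\in\mathcal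 W,\ R\in\Upsilon(\Theta)\}$. Suppose that the convex cone $Y\cap\overline C$ is finitely generated. Then $\mathrm{Fa}(Y)$ is the disjoint union of the $\mathcal W$-invariant, possibly empty, subsets $\mathrm{Fa}(Y)_\Theta$, $\Theta\subseteq I$ special facial: each $\mathrm{Fa}(Y)_\Theta$ is a $\mathcal W$-invariant subset of $\mathrm{Fa}(Y)$, and every face of $Y$ lies in $\mathrm{Fa}(Y)_\Theta$ for exactly one special facial $\Theta$. Moreover, for every special facial $\Theta\subseteq I$: (a) If $R_1,R_2\in\mathrm{Fa}(Y)_\Theta$ and $R_1\subseteq R_2$, then every maximal chain of faces of $Y$ between $R_1$ and $R_2$ is contained in $\mathrm{Fa}(Y)_\Theta$, the dimensions of its successive faces differ by one, and it is finite of length (number of members) $\dim R_2-\dim R_1+1$. (b) If $R_1,R_2\in\Upsilon(\Theta)$ and $R_1\subseteq R_2$, then $\upsilon^*(R_1)$ and $\upsilon_*(R_2)$ are disjoint and $$\upsilon^*(R_1)\cup\upsilon_*(R_2)=\bigcap_{R\in\Upsilon(\Theta),\ R_1\subseteq R\subseteq R_2}\upsilon(R).$$ -/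

import Mathlib

noncomputable section

/-! ## Cones -/

/-- The dimension of a convex cone `R`, i.e. the dimension of its linear hull `R - R`. -/
def coneDim {V : Type*} [AddCommGroup V] [Module ℝ V] (R : PointedCone ℝ V) : ℕ :=
  Module.finrank ℝ (Submodule.span ℝ (R : Set V))

/-- The relative interior of a subset of a finite dimensional real linear space, taken with respect
to the canonical topology of that space. -/
def relInterior {V : Type*} [AddCommGroup V] [Module ℝ V] (K : Set V) : Set V :=
  letI : TopologicalSpace V := moduleTopology ℝ V
  intrinsicInterior ℝ K

/-- The set `Fa(K)` of nonempty faces of a convex cone `K` which contains zero. Nonempty faces of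
such a cone are themselves convex cones which contain zero. -/
def faceSet {V : Type*} [AddCommGroup V] [Module ℝ V] (K : PointedCone ℝ V) :
    Set (PointedCone ℝ V) :=
  {F | F.IsFaceOf K}

/-! ## Matrices of finite type -/

/-- A real (indecomposable generalized Cartan) matrix `B` is of finite type if `B` is invertible,
there is a vector `u > 0` with `B u > 0`, and `B v ≥ 0` implies `v > 0` or `v = 0`. Here `> 0` and
`≥ 0` are meant componentwise. -/
def IsFiniteTypeMatrix {K : Type*} [Fintype K] [DecidableEq K] (B : Matrix K K ℝ) : Prop :=
  B.det ≠ 0 ∧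
  (∃ u : K → ℝ, (∀ k, 0 < u k) ∧ ∀ k, 0 < B.mulVec u k) ∧
  ∀ v : K → ℝ, (∀ k, 0 ≤ B.mulVec v k) → (∀ k, 0 < v k) ∨ v = 0

/-! ## Linear Coxeter systems -/

/-- Normalized generators `h i ∈ H i`, `α i ∈ L i`, `α i (h i) = 2`, of families of zero-based
closed rays `H i = ℝ₊ h i` in `𝔥` and `L i = ℝ₊ α i` in the dual of `𝔥` such that the nonzero
elements of `L i` are strictly positive on the nonzero elements of `H i`. -/
structure RayFamily (I 𝔥 : Type*) [AddCommGroup 𝔥] [Module ℝ 𝔥] where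
  /-- The generators `h i` of the rays `H i`. -/
  h : I → 𝔥
  /-- The generators `α i` of the rays `L i`. -/
  α : I → Module.Dual ℝ 𝔥
  α_h : ∀ i, α i (h i) = 2

namespace RayFamily

variable {I 𝔥 : Type*} [AddCommGroup 𝔥] [Module ℝ 𝔥] (S : RayFamily I 𝔥)

/-- The reflection `σ i : μ ↦ μ - μ (h i) • α i` on the dual of `𝔥`. -/
def σ (i : I) : Module.Dual ℝ 𝔥 ≃ₗ[ℝ] Module.Dual ℝ 𝔥 :=
  Module.reflection (x := S.α i) (f := Module.Dual.eval ℝ 𝔥 (S.h i)) (S.α_h i)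

/-- The group `W` generated by the reflections `σ i`. -/
def weylGroup : Subgroup (Module.Dual ℝ 𝔥 ≃ₗ[ℝ] Module.Dual ℝ 𝔥) :=
  Subgroup.closure (Set.range S.σ)

/-- The closed fundamental chamber: the intersection of the closed half-spaces given by the
rays `H i`. -/
def closedChamber : PointedCone ℝ (Module.Dual ℝ 𝔥) where
  carrier := {μ | ∀ i, 0 ≤ μ (S.h i)}
  zero_mem' := fun _ => le_rfl
  add_mem' := fun ha hb i => add_nonneg (ha i) (hb i)
  smul_mem' := fun c _ hx i => mul_nonneg c.2 (hx i)

/-- The open fundamental chamber. -/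
def openChamber : Set (Module.Dual ℝ 𝔥) :=
  {μ | ∀ i, 0 < μ (S.h i)}

/-- The intersection of the closed fundamental chamber with the hyperplane orthogonal to `H i`. -/
def wall (i : I) : PointedCone ℝ (Module.Dual ℝ 𝔥) where
  carrier := {μ | μ ∈ S.closedChamber ∧ μ (S.h i) = 0}
  zero_mem' := ⟨S.closedChamber.zero_mem, rfl⟩
  add_mem' := fun {a b} ha hb => ⟨S.closedChamber.add_mem ha.1 hb.1, by
    rw [LinearMap.add_apply, ha.2, hb.2, add_zero]⟩
  smul_mem' := fun c x hx => ⟨S.closedChamber.smul_mem c.2 hx.1, by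
    change (c : ℝ) * x (S.h i) = 0
    rw [hx.2, mul_zero]⟩

/-- The family of rays is a linear Coxeter system: the closed fundamental chamber spans the dual
of `𝔥`, its pairwise different 1-codimensional faces are its intersections with the hyperplanes
of the rays `H i`, and the translates of the open fundamental chamber by nontrivial elements of `W`
do not meet the open fundamental chamber. -/
structure IsLinearCoxeterSystem : Prop where
  span_closedChamber : Submodule.span ℝ (S.closedChamber : Set (Module.Dual ℝ 𝔥)) = ⊤
  wall_injective : Function.Injective S.wall
  facets : {F | F ∈ faceSet S.closedChamber ∧
      coneDim F + 1 = Module.finrank ℝ (Module.Dual ℝ 𝔥)} = Set.range S.wall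
  disjoint_openChamber : ∀ w ∈ S.weylGroup, w ≠ 1 → (w '' S.openChamber) ∩ S.openChamber = ∅

/-- The Tits cone. -/
def titsCone : Set (Module.Dual ℝ 𝔥) :=
  ⋃ w ∈ S.weylGroup, w '' (S.closedChamber : Set (Module.Dual ℝ 𝔥))

/-- The matrix `A` with entries `α j (h i)`. -/
def cartanMatrix : Matrix I I ℝ :=
  Matrix.of fun i j => S.α j (S.h i)

/-- The graph on `I` in which different `j`, `k` are adjacent if the entry of `A` at `j`, `k`
(equivalently, for a generalized Cartan matrix, the entry at `k`, `j`) is nonzero. -/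
def coxeterGraph : SimpleGraph I :=
  SimpleGraph.fromRel fun j k => S.cartanMatrix j k ≠ 0

/-- `K` is a connected component of `J ⊆ I`. -/
def IsComponent (J K : Set I) : Prop :=
  ∃ c : (S.coxeterGraph.induce J).ConnectedComponent, K = Subtype.val '' c.supp

open Classical in
/-- `K ⊆ I` is of finite type if the submatrix of `A` indexed by `K` is of finite type. -/
def IsFiniteType [Fintype I] (K : Set I) : Prop :=
  IsFiniteTypeMatrix (S.cartanMatrix.submatrix (Subtype.val : K → I) (Subtype.val : K → I))

/-- The set `J^∞`: the union of the connected components of `J` of nonfinite type. -/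
def infPart [Fintype I] (J : Set I) : Set I :=
  ⋃ (K : Set I) (_ : S.IsComponent J K ∧ ¬ S.IsFiniteType K), K

/-- `J ⊆ I` is facial if it is the set of indices of the `h i` contained in some face of the convex
cone generated by all `h i`. -/
def IsFacial (J : Set I) : Prop :=
  ∃ F ∈ faceSet (PointedCone.hull ℝ (Set.range S.h)), J = {i | S.h i ∈ F}

/-- `Θ ⊆ I` is special facial if it is facial and `Θ^∞ = Θ`. -/
def IsSpecialFacial [Fintype I] (Θ : Set I) : Prop :=
  S.infPart Θ = Θ ∧ S.IsFacial Θ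

/-! ### The cross section lattice and the type maps -/

/-- The type map: `υ(R)` is the set of the `i` such that `σ i` fixes `R` as a whole. -/
def upsilon (R : PointedCone ℝ (Module.Dual ℝ 𝔥)) : Set I :=
  {i | R.map (S.σ i : Module.Dual ℝ 𝔥 →ₗ[ℝ] Module.Dual ℝ 𝔥) = R}

/-- The lower type map: `υ_*(R)` is the set of the `i` such that `σ i` fixes `R` pointwise. -/
def upsilonLower (R : PointedCone ℝ (Module.Dual ℝ 𝔥)) : Set I :=
  {i | ∀ μ ∈ R, S.σ i μ = μ}

/-- The upper type map: `υ^*(R)` is the complement of `υ_*(R)` in `υ(R)`. -/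
def upsilonUpper (R : PointedCone ℝ (Module.Dual ℝ 𝔥)) : Set I :=
  S.upsilon R \ S.upsilonLower R

/-- The cross section lattice `Υ` of `Fa(Y)`: the faces of `Y` whose relative interiors meet the
closed fundamental chamber. -/
def crossSection (Y : PointedCone ℝ (Module.Dual ℝ 𝔥)) : Set (PointedCone ℝ (Module.Dual ℝ 𝔥)) :=
  {R | R ∈ faceSet Y ∧
    (relInterior (R : Set (Module.Dual ℝ 𝔥)) ∩
      (S.closedChamber : Set (Module.Dual ℝ 𝔥))).Nonempty}

/-- `Υ(Θ)`: the elements `R` of the cross section lattice with `υ_*(R)^∞ = Θ`. -/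
def crossSectionPart [Fintype I] (Y : PointedCone ℝ (Module.Dual ℝ 𝔥)) (Θ : Set I) :
    Set (PointedCone ℝ (Module.Dual ℝ 𝔥)) :=
  {R | R ∈ S.crossSection Y ∧ S.infPart (S.upsilonLower R) = Θ}

/-- `Fa(Y)_Θ`: the `W`-translates of the elements of `Υ(Θ)`. -/
def facePart [Fintype I] (Y : PointedCone ℝ (Module.Dual ℝ 𝔥)) (Θ : Set I) :
    Set (PointedCone ℝ (Module.Dual ℝ 𝔥)) :=
  {R | ∃ w ∈ S.weylGroup, ∃ R' ∈ S.crossSectionPart Y Θ,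
    R = R'.map (w : Module.Dual ℝ 𝔥 →ₗ[ℝ] Module.Dual ℝ 𝔥)}

end RayFamily

/-- `c` is a maximal chain between `R₁` and `R₂`: it is maximal among the chains in the
interval of all faces `R` of `Y` with `R₁ ⊆ R ⊆ R₂`. -/
def IsMaxChainBetween {V : Type*} [AddCommGroup V] [Module ℝ V] (Y R₁ R₂ : PointedCone ℝ V)
    (c : Set (PointedCone ℝ V)) : Prop :=
  Maximal (fun d : Set (PointedCone ℝ V) =>
    d ⊆ {R | R ∈ faceSet Y ∧ R₁ ≤ R ∧ R ≤ R₂} ∧ IsChain (· ≤ ·) d) c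

end

/-! Every face has an inner point, a face is determined by any one of its inner points, and a
reflection that fixes an inner point of a face stabilizes the face. Relative interiors are therefore
handled algebraically, and the Coxeter geometry enters through two consequences of the exchange
condition. By `exists_parabolic_nonneg`, the subgroup generated by the `σ j`, `j ∈ J`, moves any
point of the Tits cone to one that is nonnegative on all `h j`, `j ∈ J`. By
`isInner_of_isInner_apply`, a Weyl group orbit of faces meets the cross section in at most one face.
Hence each orbit has a well-defined type `Θ`. It is special facial because a face in the cross
section has an inner point in the chamber whose zero set is exactly `υ_*`, and this point can be
perturbed until its zero set shrinks to the nonfinite part.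

Lower type maps reverse inclusions and `infPart` is monotone, so a face between two faces of `Υ(Θ)`
has type `Θ` once it is moved into the cross section. The move can be made inside the interval: the
group used fixes the lower face pointwise, and uniqueness of representatives controls the upper one.

For gradedness it suffices that between `P < Q` of type `Θ` there is a face of dimension `dim P +
1`. Modulo the linear hull of `P`, the cone `Q` is finitely generated. With `J = υ_*(P)`, the `h j`
for `j ∈ Θ` vanish on `Q`, and `J \ Θ` generates a finite group that moves every point of `Q`, up to
adding a multiple of an inner point of `P`, into the finitely generated cone `Y ∩ C̄`. An extreme
ray of the quotient then pulls back to the required face.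

For (b), a reflection that stabilizes a face without fixing it pointwise stabilizes every larger
face. In the other direction, a reflection that fixes `R₁` pointwise and stabilizes all intermediate
faces of `Υ(Θ)` is followed upwards one dimension at a time: at each step it must fix the new face
pointwise. -/

noncomputable section

/-! ### Inner points of cones -/

section Inner

variable {V V' : Type*} [AddCommGroup V] [Module ℝ V] [AddCommGroup V'] [Module ℝ V']

/-- Algebraic description of the points of the relative interior of a cone. -/
def IsInner (R : PointedCone ℝ V) (x : V) : Prop :=
  x ∈ R ∧ ∀ y ∈ R, ∃ N : ℝ, 0 ≤ N ∧ N • x - y ∈ R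

namespace IsInner

variable {R F G Y : PointedCone ℝ V} {x y : V}

theorem add (hx : IsInner R x) (hy : y ∈ R) : IsInner R (x + y) := by
  refine ⟨R.add_mem hx.1 hy, fun z hz => ?_⟩
  obtain ⟨N, hN, h⟩ := hx.2 z hz
  refine ⟨N, hN, ?_⟩
  have : N • (x + y) - z = (N • x - z) + N • y := by module
  rw [this]
  exact R.add_mem h (PointedCone.smul_mem R hN hy)

theorem smul (hx : IsInner R x) {c : ℝ} (hc : 0 < c) : IsInner R (c • x) := by
  refine ⟨PointedCone.smul_mem R hc.le hx.1, fun z hz => ?_⟩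
  obtain ⟨N, hN, h⟩ := hx.2 z hz
  refine ⟨N / c, by positivity, ?_⟩
  rwa [smul_smul, div_mul_cancel₀ _ hc.ne']

theorem map (hx : IsInner R x) (e : V →ₗ[ℝ] V') : IsInner (R.map e) (e x) := by
  refine ⟨⟨x, hx.1, rfl⟩, ?_⟩
  rintro _ ⟨z, hz, rfl⟩
  obtain ⟨N, hN, h⟩ := hx.2 z hz
  exact ⟨N, hN, ⟨_, h, by simp⟩⟩

theorem le_of_mem (hF : F ≤ Y) (hG : G.IsFaceOf Y) (hx : IsInner F x) (hxG : x ∈ G) : F ≤ G := by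
  intro y hy
  obtain ⟨N, hN, h⟩ := hx.2 y hy
  refine hG.mem_of_add_mem_left (hF hy) (hF h) ?_
  rw [add_sub_cancel]
  exact PointedCone.smul_mem G hN hxG

theorem eq_of_inner (hF : F.IsFaceOf Y) (hG : G.IsFaceOf Y) (hx : IsInner F x)
    (hxG : IsInner G x) : F = G :=
  le_antisymm (hx.le_of_mem hF.le hG hxG.1) (hxG.le_of_mem hG.le hF hx.1)

theorem exists_smul_sub_mem (hx : IsInner R x) (hy : y ∈ Submodule.span ℝ (R : Set V)) :
    ∃ N : ℝ, 0 ≤ N ∧ N • x + y ∈ R := by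
  -- Both signs are carried through the induction, because a negative scalar interchanges them.
  suffices H : (∃ N : ℝ, 0 ≤ N ∧ N • x + y ∈ R) ∧ ∃ N : ℝ, 0 ≤ N ∧ N • x - y ∈ R from H.1
  induction hy using Submodule.span_induction with
  | mem y hy => exact ⟨⟨0, le_rfl, by simpa using hy⟩, hx.2 y hy⟩
  | zero => exact ⟨⟨0, le_rfl, by simp⟩, ⟨0, le_rfl, by simp⟩⟩
  | add y z _ _ ihy ihz =>
    obtain ⟨⟨a, ha, ha'⟩, ⟨b, hb, hb'⟩⟩ := ihy
    obtain ⟨⟨c, hc, hc'⟩, ⟨d, hd, hd'⟩⟩ := ihz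
    refine ⟨⟨a + c, by positivity, ?_⟩, ⟨b + d, by positivity, ?_⟩⟩
    · convert R.add_mem ha' hc' using 1; module
    · convert R.add_mem hb' hd' using 1; module
  | smul t y _ ih =>
    obtain ⟨⟨a, ha, ha'⟩, ⟨b, hb, hb'⟩⟩ := ih
    rcases le_total 0 t with ht | ht
    · refine ⟨⟨t * a, by positivity, ?_⟩, ⟨t * b, by positivity, ?_⟩⟩
      · convert PointedCone.smul_mem R ht ha' using 1; module
      · convert PointedCone.smul_mem R ht hb' using 1; module
    · have ht' : 0 ≤ -t := by linarith
      refine ⟨⟨-t * b, by positivity, ?_⟩, ⟨-t * a, by positivity, ?_⟩⟩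
      · convert PointedCone.smul_mem R ht' hb' using 1; module
      · convert PointedCone.smul_mem R ht' ha' using 1; module

end IsInner

/-- A basis of the linear hull can be chosen inside the cone; the sum of its members is inner, since
large multiples of it dominate every coordinate vector. -/
theorem exists_isInner [FiniteDimensional ℝ V] (R : PointedCone ℝ V) : ∃ x, IsInner R x := by
  obtain ⟨b, hbR, hspan, hli⟩ := exists_linearIndependent ℝ (R : Set V)
  have hfin : b.Finite := hli.setFinite
  have := hfin.fintype
  refine ⟨∑ v : b, (v : V), R.sum_mem fun v _ => hbR v.2, fun y hy => ?_⟩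
  have hy' : y ∈ Submodule.span ℝ (Set.range (Subtype.val : b → V)) := by
    rw [Subtype.range_coe, hspan]
    exact Submodule.subset_span hy
  obtain ⟨c, rfl⟩ := (Submodule.mem_span_range_iff_exists_fun ℝ).1 hy'
  refine ⟨∑ v : b, |c v|, Finset.sum_nonneg fun _ _ => abs_nonneg _, ?_⟩
  rw [Finset.smul_sum, ← Finset.sum_sub_distrib]
  refine R.sum_mem fun v _ => ?_
  rw [← sub_smul]
  refine PointedCone.smul_mem R ?_ (hbR v.2)
  have := Finset.single_le_sum (f := fun v : b => |c v|) (fun _ _ => abs_nonneg _)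
    (Finset.mem_univ v)
  have := le_abs_self (c v)
  linarith

theorem span_eq_of_isFaceOf {F G : PointedCone ℝ V} [FiniteDimensional ℝ V] (h : F.IsFaceOf G)
    (hs : Submodule.span ℝ (G : Set V) ≤ Submodule.span ℝ (F : Set V)) : F = G := by
  refine le_antisymm h.le fun y hy => ?_
  obtain ⟨x, hx⟩ := exists_isInner F
  obtain ⟨N, hN, h'⟩ := hx.exists_smul_sub_mem
    (Submodule.neg_mem _ (hs (Submodule.subset_span hy)))
  refine h.mem_of_add_mem_left hy (h.le h') ?_
  convert PointedCone.smul_mem F hN hx.1 using 1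
  module

theorem coneDim_mono {F G : PointedCone ℝ V} [FiniteDimensional ℝ V] (h : F ≤ G) :
    coneDim F ≤ coneDim G :=
  Submodule.finrank_mono (Submodule.span_mono h)

theorem coneDim_lt_of_isFaceOf {F G : PointedCone ℝ V} [FiniteDimensional ℝ V]
    (h : F.IsFaceOf G) (hne : F ≠ G) : coneDim F < coneDim G := by
  refine lt_of_le_of_ne (coneDim_mono h.le) fun he => hne (span_eq_of_isFaceOf h ?_)
  exact (Submodule.eq_of_le_of_finrank_eq (Submodule.span_mono h.le) he).ge

theorem coneDim_map (R : PointedCone ℝ V) (e : V ≃ₗ[ℝ] V') :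
    coneDim (R.map (e : V →ₗ[ℝ] V')) = coneDim R := by
  unfold coneDim
  rw [PointedCone.coe_map, Submodule.span_image]
  exact LinearEquiv.finrank_map_eq e _

theorem mem_relInterior_iff [FiniteDimensional ℝ V] (R : PointedCone ℝ V) (x : V) :
    x ∈ relInterior (R : Set V) ↔ IsInner R x := by
  unfold relInterior
  let _ : TopologicalSpace V := moduleTopology ℝ V
  have _ : IsModuleTopology ℝ V := ⟨rfl⟩
  have _ : ContinuousAdd V := IsModuleTopology.toContinuousAdd ℝ V
  have _ : ContinuousSMul ℝ V := IsModuleTopology.toContinuousSMul ℝ V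
  rw [mem_intrinsicInterior]
  constructor
  · rintro ⟨z, hz, rfl⟩
    have hz' := interior_subset hz
    refine ⟨hz', fun y hy => ?_⟩
    -- The affine span contains zero, so moving from `z` in the direction `-y` stays inside it;
    -- openness then allows a small positive step.
    have hmem : ∀ t : ℝ, (z : V) - t • y ∈ affineSpan ℝ (R : Set V) := fun t => by
      have := (affineSpan ℝ (R : Set V)).smul_vsub_vadd_mem t
        (subset_affineSpan ℝ (R : Set V) R.zero_mem) (subset_affineSpan ℝ (R : Set V) hy) z.2
      simpa [sub_eq_neg_add] using this
    let f : ℝ → affineSpan ℝ (R : Set V) := fun t => ⟨z - t • y, hmem t⟩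
    have hneg : Continuous fun t : ℝ => (z : V) - t • y := by
      have : (fun t : ℝ => (z : V) - t • y) = fun t : ℝ => (z : V) + (-t) • y := by
        ext t; module
      rw [this]
      fun_prop
    have hf : Continuous f := Continuous.subtype_mk hneg _
    have h0 : f 0 = z := Subtype.ext (by simp [f])
    have hn : f ⁻¹' interior ((↑) ⁻¹' (R : Set V)) ∈ nhds (0 : ℝ) :=
      hf.continuousAt.preimage_mem_nhds (isOpen_interior.mem_nhds (by rwa [h0]))
    obtain ⟨ε, hε, hball⟩ := Metric.mem_nhds_iff.1 hn
    have h1 : (z : V) - (ε / 2) • y ∈ R := by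
      have : ε / 2 ∈ Metric.ball (0 : ℝ) ε := by
        rw [Metric.mem_ball, Real.dist_eq, sub_zero, abs_of_pos (by positivity)]
        linarith
      have h2 := interior_subset (hball this)
      exact h2
    refine ⟨(ε / 2)⁻¹, by positivity, ?_⟩
    convert PointedCone.smul_mem R (by positivity : 0 ≤ (ε / 2)⁻¹) h1 using 1
    rw [smul_sub, smul_smul, inv_mul_cancel₀ (by positivity), one_smul]
  · intro hx
    let L := Submodule.span ℝ (R : Set V)
    obtain ⟨p, hp⟩ := LinearMap.exists_leftInverse_of_injective L.subtype (by simp)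
    let b := Module.finBasis ℝ L
    have hpb : ∀ v ∈ L, ∑ i, (b.repr (p v) i) • (b i : V) = v := by
      intro v hv
      have h1 : p v = ⟨v, hv⟩ := LinearMap.congr_fun hp ⟨v, hv⟩
      have h2 := congrArg L.subtype (b.sum_repr (p v))
      simp only [map_sum, map_smul, Submodule.subtype_apply] at h2
      rw [h2, h1]
    have hN : ∃ N : ℝ, 0 ≤ N ∧ ∀ i, N • x + (b i : V) ∈ R ∧ N • x - (b i : V) ∈ R := by
      choose N1 hN1 h1 using fun i => hx.exists_smul_sub_mem (b i).2
      choose N2 hN2 h2 using fun i => hx.exists_smul_sub_mem (Submodule.neg_mem _ (b i).2)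
      have hle1 := fun i => Finset.single_le_sum (f := N1) (fun j _ => hN1 j) (Finset.mem_univ i)
      have hle2 := fun i => Finset.single_le_sum (f := N2) (fun j _ => hN2 j) (Finset.mem_univ i)
      have hs1 := Finset.sum_nonneg (s := Finset.univ) fun j _ => hN1 j
      have hs2 := Finset.sum_nonneg (s := Finset.univ) fun j _ => hN2 j
      refine ⟨∑ i, N1 i + ∑ i, N2 i, by linarith, fun i => ⟨?_, ?_⟩⟩
      · convert R.add_mem (h1 i) (PointedCone.smul_mem R (r := ∑ i, N1 i + ∑ i, N2 i - N1 i)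
          (by linarith [hle1 i]) hx.1) using 1
        module
      · convert R.add_mem (h2 i) (PointedCone.smul_mem R (r := ∑ i, N1 i + ∑ i, N2 i - N2 i)
          (by linarith [hle2 i]) hx.1) using 1
        module
    obtain ⟨N, hN0, hN⟩ := hN
    have hN' : ∀ i (c : ℝ), (|c| * N) • x + c • (b i : V) ∈ R := by
      intro i c
      rcases le_total 0 c with hc | hc
      · rw [abs_of_nonneg hc]
        convert PointedCone.smul_mem R hc (hN i).1 using 1
        module
      · rw [abs_of_nonpos hc]
        convert PointedCone.smul_mem R (by linarith : 0 ≤ -c) (hN i).2 using 1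
        module
    -- Writing `v - x` in the basis, each coordinate `c` costs `|c| * N` copies of `x` to keep `c •
    -- b i` in the cone. On the open set where the total cost `g v` is below one, `x` itself pays
    -- for it, so `v` stays in `R`.
    let g : V → ℝ := fun v => ∑ i, |b.repr (p v) i - b.repr (p x) i| * N
    have hg : Continuous g := by
      refine continuous_finsetSum _ fun i _ => ?_
      have : Continuous fun v => b.repr (p v) i := by
        let l : V →ₗ[ℝ] ℝ := (b.coord i).comp p
        exact IsModuleTopology.continuous_of_linearMap l
      exact ((this.sub continuous_const).abs).mul continuous_const
    have hxa : x ∈ affineSpan ℝ (R : Set V) := subset_affineSpan ℝ _ hx.1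
    refine ⟨⟨x, hxa⟩, ?_, rfl⟩
    rw [mem_interior]
    refine ⟨{v | g v < 1}, ?_, isOpen_lt (hg.comp continuous_subtype_val) continuous_const, ?_⟩
    · rintro ⟨v, hv⟩ hgv
      simp only [Set.mem_ofPred_eq, g] at hgv
      have hvL : v ∈ L := affineSpan_subset_span hv
      have hxL : x ∈ L := Submodule.subset_span hx.1
      have key : v = (1 - ∑ i, |b.repr (p v) i - b.repr (p x) i| * N) • x +
          ∑ i, ((|b.repr (p v) i - b.repr (p x) i| * N) • x +
            (b.repr (p v) i - b.repr (p x) i) • (b i : V)) := by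
        simp only [Finset.sum_add_distrib, sub_smul, Finset.sum_sub_distrib, hpb v hvL,
          hpb x hxL, ← Finset.sum_smul]
        module
      change v ∈ R
      rw [key]
      exact R.add_mem (PointedCone.smul_mem R (by linarith) hx.1)
        (R.sum_mem fun i _ => hN' i _)
    · simp [g]

namespace PointedCone

theorem map_equiv_mul (R : PointedCone ℝ V) (v w : V ≃ₗ[ℝ] V) :
    R.map ((v * w : V ≃ₗ[ℝ] V) : V →ₗ[ℝ] V) =
      (R.map (w : V →ₗ[ℝ] V)).map (v : V →ₗ[ℝ] V) :=
  (PointedCone.map_map _ _ _).symm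

theorem map_inv_map (R : PointedCone ℝ V) (w : V ≃ₗ[ℝ] V) :
    (R.map (w : V →ₗ[ℝ] V)).map ((w⁻¹ : V ≃ₗ[ℝ] V) : V →ₗ[ℝ] V) = R := by
  rw [← map_equiv_mul, inv_mul_cancel]
  exact R.map_id

theorem map_equiv_le_map_iff {R R' : PointedCone ℝ V} (w : V ≃ₗ[ℝ] V) :
    R.map (w : V →ₗ[ℝ] V) ≤ R'.map (w : V →ₗ[ℝ] V) ↔ R ≤ R' :=
  Set.image_subset_image_iff w.injective

end PointedCone

end Inner

/-! ### Geometry of linear Coxeter systems -/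

theorem exists_forall_pos_mul_add {ι : Type*} [Finite ι] (s : Set ι) (a b : ι → ℝ)
    (ha : ∀ i ∈ s, 0 < a i) : ∃ N₀ : ℝ, 0 < N₀ ∧ ∀ N, N₀ ≤ N → ∀ i ∈ s, 0 < N * a i + b i := by
  have := Fintype.ofFinite ι
  -- The absolute values make the terms with index outside `s` nonnegative too (zero when `a i =
  -- 0`), so each single term is bounded by the sum.
  refine ⟨1 + ∑ i, |b i| / |a i|, by positivity, fun N hN i hi => ?_⟩
  have h1 := Finset.single_le_sum (f := fun i => |b i| / |a i|) (fun j _ => by positivity)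
    (Finset.mem_univ i)
  have hai := ha i hi
  have h2 : |b i| / |a i| < N := by linarith
  rw [abs_of_pos hai, div_lt_iff₀ hai] at h2
  linarith [neg_abs_le (b i)]

namespace RayFamily

section Basic

variable {I 𝔥 : Type*} [AddCommGroup 𝔥] [Module ℝ 𝔥] (S : RayFamily I 𝔥)

theorem σ_apply (i : I) (μ : Module.Dual ℝ 𝔥) : S.σ i μ = μ - μ (S.h i) • S.α i := rfl

@[simp]
theorem σ_apply_self (i : I) (μ : Module.Dual ℝ 𝔥) : S.σ i (S.σ i μ) = μ :=
  Module.involutive_reflection (f := Module.Dual.eval ℝ 𝔥 (S.h i)) (S.α_h i) μ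

@[simp]
theorem σ_mul_self (i : I) : S.σ i * S.σ i = 1 := LinearEquiv.ext (S.σ_apply_self i)

@[simp]
theorem σ_inv (i : I) : (S.σ i)⁻¹ = S.σ i := rfl

theorem σ_apply_h (i : I) (μ : Module.Dual ℝ 𝔥) : (S.σ i μ) (S.h i) = -μ (S.h i) := by
  rw [σ_apply]
  simp [S.α_h]
  ring

theorem σ_ne_one (i : I) : S.σ i ≠ 1 := fun h => by
  have h1 := S.σ_apply_h i (S.α i)
  rw [h] at h1
  simp [S.α_h] at h1
  norm_num at h1

theorem σ_apply_eq_self_iff (i : I) (μ : Module.Dual ℝ 𝔥) : S.σ i μ = μ ↔ μ (S.h i) = 0 := by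
  constructor
  · intro h
    have := S.σ_apply_h i μ
    rw [h] at this
    linarith
  · intro h
    simp [σ_apply, h]

/-- The subgroup generated by the reflections with indices in `J`. -/
def parabolic (J : Set I) : Subgroup (Module.Dual ℝ 𝔥 ≃ₗ[ℝ] Module.Dual ℝ 𝔥) :=
  Subgroup.closure (S.σ '' J)

theorem parabolic_univ : S.parabolic Set.univ = S.weylGroup := by
  rw [parabolic, weylGroup, Set.image_univ]

theorem parabolic_mono {J K : Set I} (h : J ⊆ K) : S.parabolic J ≤ S.parabolic K :=
  Subgroup.closure_mono (Set.image_mono h)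

theorem parabolic_le (J : Set I) : S.parabolic J ≤ S.weylGroup :=
  S.parabolic_univ ▸ S.parabolic_mono (Set.subset_univ J)

theorem σ_mem_parabolic {J : Set I} {i : I} (hi : i ∈ J) : S.σ i ∈ S.parabolic J :=
  Subgroup.subset_closure ⟨i, hi, rfl⟩

theorem σ_mem_weylGroup (i : I) : S.σ i ∈ S.weylGroup := Subgroup.subset_closure ⟨i, rfl⟩

/-- The product of the reflections along a word. -/
def wordProd (l : List I) : Module.Dual ℝ 𝔥 ≃ₗ[ℝ] Module.Dual ℝ 𝔥 := (l.map S.σ).prod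

@[simp] theorem wordProd_nil : S.wordProd [] = 1 := rfl

@[simp] theorem wordProd_cons (i : I) (l : List I) :
    S.wordProd (i :: l) = S.σ i * S.wordProd l := by simp [wordProd]

@[simp] theorem wordProd_append (l l' : List I) :
    S.wordProd (l ++ l') = S.wordProd l * S.wordProd l' := by simp [wordProd]

theorem wordProd_mem {J : Set I} {l : List I} (hl : ∀ i ∈ l, i ∈ J) :
    S.wordProd l ∈ S.parabolic J := by
  refine Subgroup.list_prod_mem _ fun x hx => ?_
  obtain ⟨i, hi, rfl⟩ := List.mem_map.1 hx
  exact S.σ_mem_parabolic (hl i hi)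

theorem exists_word {J : Set I} {w : Module.Dual ℝ 𝔥 ≃ₗ[ℝ] Module.Dual ℝ 𝔥}
    (hw : w ∈ S.parabolic J) : ∃ l : List I, (∀ i ∈ l, i ∈ J) ∧ S.wordProd l = w := by
  induction hw using Subgroup.closure_induction with
  | mem x hx =>
    obtain ⟨i, hi, rfl⟩ := hx
    exact ⟨[i], by simpa using hi, by simp⟩
  | one => exact ⟨[], by simp, rfl⟩
  | mul x y _ _ hx hy =>
    obtain ⟨l, hl, rfl⟩ := hx
    obtain ⟨l', hl', rfl⟩ := hy
    refine ⟨l ++ l', ?_, by simp⟩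
    simp only [List.mem_append]
    rintro i (h | h)
    exacts [hl i h, hl' i h]
  | inv x _ hx =>
    obtain ⟨l, hl, rfl⟩ := hx
    refine ⟨l.reverse, by simpa using hl, ?_⟩
    induction l with
    | nil => simp
    | cons i l ih =>
      simp only [List.reverse_cons, wordProd_append, wordProd_cons, wordProd_nil, mul_one,
        mul_inv_rev, σ_inv]
      have hl' : ∀ i ∈ l, i ∈ J := fun i hi => hl i (List.mem_cons_of_mem _ hi)
      rw [ih hl' (S.wordProd_mem hl')]

theorem exists_word_of_mem_weylGroup {w : Module.Dual ℝ 𝔥 ≃ₗ[ℝ] Module.Dual ℝ 𝔥}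
    (hw : w ∈ S.weylGroup) : ∃ l : List I, S.wordProd l = w := by
  rw [← parabolic_univ] at hw
  obtain ⟨l, -, h⟩ := S.exists_word hw
  exact ⟨l, h⟩

theorem wordProd_mem_weylGroup (l : List I) : S.wordProd l ∈ S.weylGroup :=
  S.parabolic_univ ▸ S.wordProd_mem (J := Set.univ) (by simp)

theorem parabolic_apply_eq_self {J : Set I} {w : Module.Dual ℝ 𝔥 ≃ₗ[ℝ] Module.Dual ℝ 𝔥}
    (hw : w ∈ S.parabolic J) {μ : Module.Dual ℝ 𝔥} (hμ : ∀ i ∈ J, μ (S.h i) = 0) :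
    w μ = μ := by
  induction hw using Subgroup.closure_induction with
  | mem x hx =>
    obtain ⟨i, hi, rfl⟩ := hx
    exact (S.σ_apply_eq_self_iff i μ).2 (hμ i hi)
  | one => rfl
  | mul x y _ _ hx hy => rw [LinearEquiv.mul_apply, hy, hx]
  | inv x _ hx =>
    rw [← hx]
    exact (LinearEquiv.symm_apply_apply x μ).trans hx.symm

theorem isFaceOf_map {Y R : PointedCone ℝ (Module.Dual ℝ 𝔥)}
    (hY : ∀ w ∈ S.weylGroup, ∀ μ ∈ Y, w μ ∈ Y) (hR : R.IsFaceOf Y)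
    {w : Module.Dual ℝ 𝔥 ≃ₗ[ℝ] Module.Dual ℝ 𝔥} (hw : w ∈ S.weylGroup) :
    (R.map (w : Module.Dual ℝ 𝔥 →ₗ[ℝ] Module.Dual ℝ 𝔥)).IsFaceOf Y := by
  have hYw : Y.map (w : Module.Dual ℝ 𝔥 →ₗ[ℝ] Module.Dual ℝ 𝔥) = Y := by
    ext μ
    constructor
    · rintro ⟨x, hx, rfl⟩
      exact hY w hw x hx
    · intro hμ
      exact ⟨w⁻¹ μ, hY _ (inv_mem hw) μ hμ, w.apply_symm_apply μ⟩
  have := hR.map_equiv w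
  rwa [hYw] at this

theorem map_eq_of_apply_eq {Y R : PointedCone ℝ (Module.Dual ℝ 𝔥)}
    (hY : ∀ w ∈ S.weylGroup, ∀ μ ∈ Y, w μ ∈ Y) (hR : R.IsFaceOf Y)
    {w : Module.Dual ℝ 𝔥 ≃ₗ[ℝ] Module.Dual ℝ 𝔥} (hw : w ∈ S.weylGroup)
    {q : Module.Dual ℝ 𝔥} (hq : IsInner R q) (hwq : w q = q) :
    R.map (w : Module.Dual ℝ 𝔥 →ₗ[ℝ] Module.Dual ℝ 𝔥) = R := by
  refine IsInner.eq_of_inner (S.isFaceOf_map hY hR hw) hR (x := q) ?_ hq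
  have := hq.map (w : Module.Dual ℝ 𝔥 →ₗ[ℝ] Module.Dual ℝ 𝔥)
  rwa [LinearEquiv.coe_coe, hwq] at this

theorem mem_openChamber {μ : Module.Dual ℝ 𝔥} :
    μ ∈ S.openChamber ↔ ∀ i, 0 < μ (S.h i) := Iff.rfl

end Basic

variable {I 𝔥 : Type*} [AddCommGroup 𝔥] [Module ℝ 𝔥] {S : RayFamily I 𝔥}

/-! ### Chambers, walls, and the exchange condition -/

namespace IsLinearCoxeterSystem

theorem eq_one_of_mem (hS : S.IsLinearCoxeterSystem)
    {w : Module.Dual ℝ 𝔥 ≃ₗ[ℝ] Module.Dual ℝ 𝔥} (hw : w ∈ S.weylGroup) {μ : Module.Dual ℝ 𝔥}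
    (hμ : μ ∈ S.openChamber) (hwμ : w μ ∈ S.openChamber) : w = 1 := by
  by_contra hne
  have h := hS.disjoint_openChamber w hw hne
  exact Set.eq_empty_iff_forall_notMem.1 h (w μ) ⟨⟨μ, hμ, rfl⟩, hwμ⟩

/-- If a translate of the open chamber met the hyperplane of `h i`, a conjugate of `σ i` would fix a
point of the open chamber and so be trivial. If it met both sides, convexity would produce such a
point. -/
theorem pos_or_neg (hS : S.IsLinearCoxeterSystem)
    {w : Module.Dual ℝ 𝔥 ≃ₗ[ℝ] Module.Dual ℝ 𝔥} (hw : w ∈ S.weylGroup) (i : I) :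
    (∀ μ ∈ S.openChamber, 0 < (w μ) (S.h i)) ∨ (∀ μ ∈ S.openChamber, (w μ) (S.h i) < 0) := by
  have hne : ∀ μ ∈ S.openChamber, (w μ) (S.h i) ≠ 0 := by
    intro μ hμ h0
    have h1 : (w⁻¹ * S.σ i * w) μ = μ := by
      rw [LinearEquiv.mul_apply, LinearEquiv.mul_apply, (S.σ_apply_eq_self_iff i _).2 h0]
      exact w.symm_apply_apply μ
    have h2 := hS.eq_one_of_mem
      (mul_mem (mul_mem (inv_mem hw) (S.σ_mem_weylGroup i)) hw) hμ (by rwa [h1])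
    refine S.σ_ne_one i ?_
    rw [mul_assoc, inv_mul_eq_one] at h2
    exact (mul_eq_right.1 h2.symm)
  by_contra! hc
  obtain ⟨⟨a, ha, ha'⟩, ⟨b, hb, hb'⟩⟩ := hc
  have ha'' := lt_of_le_of_ne ha' (hne a ha)
  have hb'' := lt_of_le_of_ne hb' (hne b hb).symm
  refine hne ((w b) (S.h i) • a + (-(w a) (S.h i)) • b) (fun j => ?_) ?_
  · simp only [LinearMap.add_apply, LinearMap.smul_apply, smul_eq_mul]
    have h1 := mul_pos hb'' (ha j)
    have h2 := mul_pos (neg_pos.2 ha'') (hb j)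
    linarith
  · simp only [map_add, map_smul, LinearMap.add_apply, LinearMap.smul_apply, smul_eq_mul]
    ring

variable [Fintype I]

theorem exists_mem_openChamber (hS : S.IsLinearCoxeterSystem) : ∃ ρ, ρ ∈ S.openChamber := by
  have h : ∀ i, ∃ μ ∈ S.closedChamber, 0 < μ (S.h i) := by
    intro i
    by_contra! hc
    have hle : Submodule.span ℝ (S.closedChamber : Set (Module.Dual ℝ 𝔥)) ≤
        LinearMap.ker (Module.Dual.eval ℝ 𝔥 (S.h i)) := by
      rw [Submodule.span_le]
      exact fun μ hμ => le_antisymm (hc μ hμ) (hμ i)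
    rw [hS.span_closedChamber] at hle
    have : S.α i (S.h i) = 0 := hle (Submodule.mem_top (x := S.α i))
    rw [S.α_h] at this
    norm_num at this
  choose μ hμ hpos using h
  refine ⟨∑ i, μ i, fun j => ?_⟩
  rw [LinearMap.sum_apply]
  exact Finset.sum_pos' (fun i _ => hμ i j) ⟨j, Finset.mem_univ j, hpos j⟩

/-- If `h j` vanished on the wall of `k`, the codimension-one wall would span both kernels, so the
kernels and hence the two walls would coincide. Summing points that witness the separate
inequalities gives a point generic in the wall. -/
theorem exists_mem_wall [FiniteDimensional ℝ 𝔥] (hS : S.IsLinearCoxeterSystem) (k : I) :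
    ∃ p : Module.Dual ℝ 𝔥, p (S.h k) = 0 ∧ ∀ j, j ≠ k → 0 < p (S.h j) := by
  have hwall : ∀ i μ, μ ∈ S.wall i ↔ μ ∈ S.closedChamber ∧ μ (S.h i) = 0 := fun _ _ => Iff.rfl
  have h : ∀ j, ∃ μ ∈ S.wall k, j ≠ k → 0 < μ (S.h j) := by
    intro j
    rcases eq_or_ne j k with rfl | hjk
    · exact ⟨0, (S.wall j).zero_mem, fun h => absurd rfl h⟩
    by_contra! hc
    have hk : S.wall k ∈ {F | F ∈ faceSet S.closedChamber ∧
      coneDim F + 1 = Module.finrank ℝ (Module.Dual ℝ 𝔥)} := by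
      rw [hS.facets]; exact ⟨k, rfl⟩
    have hdim := hk.2
    have hspan : ∀ i, (∀ μ ∈ S.wall k, μ (S.h i) = 0) →
        Submodule.span ℝ (S.wall k : Set (Module.Dual ℝ 𝔥)) =
          LinearMap.ker (Module.Dual.eval ℝ 𝔥 (S.h i)) := by
      intro i hi
      refine Submodule.eq_of_le_of_finrank_eq (Submodule.span_le.2 hi) ?_
      have hne : Module.Dual.eval ℝ 𝔥 (S.h i) ≠ 0 := fun h0 => by
        have := LinearMap.congr_fun h0 (S.α i)
        simp [S.α_h] at this
      have := Module.Dual.finrank_ker_add_one_of_ne_zero hne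
      unfold coneDim at hdim
      omega
    have hker := (hspan k fun μ hμ => hμ.2).symm.trans
      (hspan j fun μ hμ => le_antisymm (hc μ hμ).2 (hμ.1 j))
    refine hjk (hS.wall_injective ?_)
    ext μ
    rw [hwall, hwall]
    have := SetLike.ext_iff.1 hker μ
    simp only [LinearMap.mem_ker, Module.Dual.eval_apply] at this
    rw [this]
  choose μ hμ hpos using h
  refine ⟨∑ i, μ i, ?_, fun j hj => ?_⟩
  · rw [LinearMap.sum_apply]
    exact Finset.sum_eq_zero fun i _ => (hμ i).2
  · rw [LinearMap.sum_apply]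
    exact Finset.sum_pos' (fun i _ => (hμ i).1 j) ⟨j, Finset.mem_univ j, hpos j hj⟩

theorem nonneg_of_pos (hS : S.IsLinearCoxeterSystem)
    {f : Module.Dual ℝ 𝔥 →ₗ[ℝ] ℝ} (hf : ∀ μ ∈ S.openChamber, 0 < f μ)
    {μ : Module.Dual ℝ 𝔥} (hμ : μ ∈ S.closedChamber) : 0 ≤ f μ := by
  obtain ⟨ρ, hρ⟩ := hS.exists_mem_openChamber
  by_contra! hlt
  have hρ' := hf ρ hρ
  have h1 : μ + (-f μ / f ρ) • ρ ∈ S.openChamber := fun i => by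
    have := mul_pos (div_pos (neg_pos.2 hlt) hρ') (hρ i)
    have := hμ i
    simp only [LinearMap.add_apply, LinearMap.smul_apply, smul_eq_mul]
    linarith
  have h2 := hf _ h1
  rw [map_add, map_smul, smul_eq_mul, div_mul_cancel₀ _ hρ'.ne'] at h2
  linarith

theorem apply_nonneg (hS : S.IsLinearCoxeterSystem)
    {w : Module.Dual ℝ 𝔥 ≃ₗ[ℝ] Module.Dual ℝ 𝔥} {i : I}
    (h : ∀ μ ∈ S.openChamber, 0 < (w μ) (S.h i))
    {μ : Module.Dual ℝ 𝔥} (hμ : μ ∈ S.closedChamber) : 0 ≤ (w μ) (S.h i) :=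
  hS.nonneg_of_pos (f := (Module.Dual.eval ℝ 𝔥 (S.h i)).comp w.toLinearMap) h hμ

theorem apply_nonpos (hS : S.IsLinearCoxeterSystem)
    {w : Module.Dual ℝ 𝔥 ≃ₗ[ℝ] Module.Dual ℝ 𝔥} {i : I}
    (h : ∀ μ ∈ S.openChamber, (w μ) (S.h i) < 0)
    {μ : Module.Dual ℝ 𝔥} (hμ : μ ∈ S.closedChamber) : (w μ) (S.h i) ≤ 0 := by
  have := hS.nonneg_of_pos (f := -(Module.Dual.eval ℝ 𝔥 (S.h i)).comp w.toLinearMap)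
    (fun μ hμ => neg_pos.2 (h μ hμ)) hμ
  exact neg_nonneg.1 this

variable [FiniteDimensional ℝ 𝔥]

/-- The adjacent chambers `v C` and `v σ_k C` lie on opposite sides of the hyperplane of `h i`, so
that hyperplane contains their common wall and `h i ∘ v` is proportional to `h k`. The element `σ_k
v⁻¹ σ_i v` then fixes the generic wall point `p` and preserves the side of `C`, so it maps points of
`C` near the ray of `p` back into `C` and is trivial. -/
theorem σ_mul_eq_mul_σ (hS : S.IsLinearCoxeterSystem)
    {v : Module.Dual ℝ 𝔥 ≃ₗ[ℝ] Module.Dual ℝ 𝔥} (hv : v ∈ S.weylGroup) {i k : I}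
    (hpos : ∀ μ ∈ S.openChamber, 0 < (v μ) (S.h i))
    (hneg : ∀ μ ∈ S.openChamber, ((v * S.σ k) μ) (S.h i) < 0) : S.σ i * v = v * S.σ k := by
  obtain ⟨ρ, hρ⟩ := hS.exists_mem_openChamber
  obtain ⟨p, hpk, hp⟩ := hS.exists_mem_wall k
  have hzero : ∀ y ∈ S.closedChamber, y (S.h k) = 0 → (v y) (S.h i) = 0 := fun y hy hyk => by
    refine le_antisymm ?_ (hS.apply_nonneg hpos hy)
    have := hS.apply_nonpos hneg hy
    rwa [LinearEquiv.mul_apply, (S.σ_apply_eq_self_iff k y).2 hyk] at this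
  have hker : ∀ x : Module.Dual ℝ 𝔥, x (S.h k) = 0 → (v x) (S.h i) = 0 := by
    intro x hx
    -- Every `x` in the kernel of `h k` is the difference of the wall points `N • p + x` and `N •
    -- p`.
    obtain ⟨N, hN, hN'⟩ := exists_forall_pos_mul_add {j | j ≠ k} (fun j => p (S.h j))
      (fun j => x (S.h j)) hp
    have h1 := hzero (N • p + x) (fun j => by
      rcases eq_or_ne j k with rfl | hj
      · simp [hpk, hx]
      · exact (hN' N le_rfl j hj).le) (by simp [hpk, hx])
    have h2 := hzero p (fun j => by
      rcases eq_or_ne j k with rfl | hj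
      · exact hpk.ge
      · exact (hp j hj).le) hpk
    simpa [h2] using h1
  have hform : ∀ y : Module.Dual ℝ 𝔥,
      (v y) (S.h i) * ρ (S.h k) = y (S.h k) * (v ρ) (S.h i) := by
    intro y
    have h1 := hker (ρ (S.h k) • y - y (S.h k) • ρ) (by simp; ring)
    simp only [map_sub, map_smul, LinearMap.sub_apply, LinearMap.smul_apply, smul_eq_mul] at h1
    linarith
  let g := S.σ k * v⁻¹ * S.σ i * v
  have hg : g ∈ S.weylGroup :=
    mul_mem (mul_mem (mul_mem (S.σ_mem_weylGroup k) (inv_mem hv)) (S.σ_mem_weylGroup i)) hv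
  have hgp : g p = p := by
    simp only [g, LinearEquiv.mul_apply]
    rw [(S.σ_apply_eq_self_iff i _).2 (hker p hpk)]
    have : v⁻¹ (v p) = p := v.symm_apply_apply p
    rw [this, (S.σ_apply_eq_self_iff k _).2 hpk]
  have hgρ : 0 < (g ρ) (S.h k) := by
    simp only [g, LinearEquiv.mul_apply]
    rw [σ_apply_h]
    have h1 := hform (v⁻¹ (S.σ i (v ρ)))
    have h2 : v (v⁻¹ (S.σ i (v ρ))) = S.σ i (v ρ) := v.apply_symm_apply _
    rw [h2, σ_apply_h] at h1
    have h3 := hpos ρ hρ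
    have h4 : (v⁻¹ (S.σ i (v ρ))) (S.h k) = - ρ (S.h k) := by
      refine mul_right_cancel₀ h3.ne' ?_
      linarith
    rw [h4, neg_neg]
    exact hρ k
  obtain ⟨N, hN, hN'⟩ := exists_forall_pos_mul_add {j | j ≠ k} (fun j => p (S.h j))
      (fun j => (g ρ) (S.h j)) hp
  have h1 : N • p + ρ ∈ S.openChamber := fun j => by
    have := hρ j
    rcases eq_or_ne j k with rfl | hj
    · simpa [hpk] using this
    · have := mul_pos hN (hp j hj)
      simp only [LinearMap.add_apply, LinearMap.smul_apply, smul_eq_mul]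
      linarith
  have h2 : g (N • p + ρ) ∈ S.openChamber := fun j => by
    rw [map_add, map_smul, hgp]
    rcases eq_or_ne j k with rfl | hj
    · simpa [hpk] using hgρ
    · exact hN' N le_rfl j hj
  have h3 : S.σ k * v⁻¹ * S.σ i * v = 1 := hS.eq_one_of_mem hg h1 h2
  calc S.σ i * v = (v * S.σ k) * (S.σ k * v⁻¹ * S.σ i * v) := by
        simp only [mul_assoc]
        rw [← mul_assoc (S.σ k), σ_mul_self, one_mul, ← mul_assoc v, mul_inv_cancel, one_mul]
    _ = _ := by rw [h3, mul_one]

/-- The exchange condition. -/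
theorem exchange (hS : S.IsLinearCoxeterSystem) (i : I) (l : List I)
    (hneg : ∀ μ ∈ S.openChamber, (S.wordProd l μ) (S.h i) < 0) :
    ∃ l' : List I, l'.length < l.length ∧ S.σ i * S.wordProd l = S.wordProd l' := by
  obtain ⟨ρ, hρ⟩ := hS.exists_mem_openChamber
  -- Along the gallery of the word, the last step either crosses the hyperplane of `h i`, and its
  -- letter is then cancelled, or does not, and the crossing occurs earlier.
  induction l using List.reverseRecOn with
  | nil => exact absurd (hneg ρ hρ) (not_lt.2 (hρ i).le)
  | append_singleton l k ih =>
    rcases hS.pos_or_neg (S.wordProd_mem_weylGroup l) i with h | h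
    · refine ⟨l, by simp, ?_⟩
      simp only [wordProd_append, wordProd_cons, wordProd_nil, mul_one] at hneg ⊢
      rw [← mul_assoc, hS.σ_mul_eq_mul_σ (S.wordProd_mem_weylGroup l) h hneg, mul_assoc,
        σ_mul_self, mul_one]
    · obtain ⟨l', h1, h3⟩ := ih h
      exact ⟨l' ++ [k], by simpa using h1, by
        rw [wordProd_append, wordProd_append, ← mul_assoc, h3]⟩

/-- As long as some `h j`, `j ∈ J`, is negative on the translated chamber, exchange makes `σ j`
shorten the word; the descent ends at a point nonnegative on all of `J`. -/
theorem exists_parabolic_nonneg (hS : S.IsLinearCoxeterSystem) (J : Set I)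
    {x : Module.Dual ℝ 𝔥} (hx : x ∈ S.titsCone) :
    ∃ v ∈ S.parabolic J, ∀ j ∈ J, 0 ≤ (v x) (S.h j) := by
  simp only [titsCone, Set.mem_iUnion] at hx
  obtain ⟨w, hw, ν, hν, rfl⟩ := hx
  obtain ⟨l, rfl⟩ := S.exists_word_of_mem_weylGroup hw
  clear hw
  induction hn : l.length using Nat.strong_induction_on generalizing l with
  | _ n ih =>
    by_cases h : ∃ j ∈ J, ∀ μ ∈ S.openChamber, (S.wordProd l μ) (S.h j) < 0
    · obtain ⟨j, hj, hneg⟩ := h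
      obtain ⟨l', h1, h3⟩ := hS.exchange j l hneg
      obtain ⟨v, hv, hv'⟩ := ih l'.length (by omega) l' rfl
      refine ⟨v * S.σ j, mul_mem hv (S.σ_mem_parabolic hj), ?_⟩
      rw [← h3] at hv'
      exact hv'
    · push Not at h
      refine ⟨1, one_mem _, fun j hj => ?_⟩
      rcases hS.pos_or_neg (S.wordProd_mem_weylGroup l) j with h' | h'
      · exact hS.apply_nonneg h' hν
      · obtain ⟨μ, hμ, hμ'⟩ := h j hj
        exact absurd (h' μ hμ) (not_lt.2 hμ')

/-- This is the fundamental domain property for faces, by induction on the word. If its first letter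
does not separate, the word can be shortened. Otherwise `w μ` and `ν` lie weakly on opposite sides
of a reflecting hyperplane, so some inner point of `R` lies on it, the reflection stabilizes `R`,
and the letter can be dropped. -/
theorem isInner_of_isInner_apply (hS : S.IsLinearCoxeterSystem)
    {Y R : PointedCone ℝ (Module.Dual ℝ 𝔥)}
    (hY : ∀ w ∈ S.weylGroup, ∀ μ ∈ Y, w μ ∈ Y) (hR : R.IsFaceOf Y)
    {ν μ : Module.Dual ℝ 𝔥} (hν : ν ∈ S.closedChamber) (hνR : IsInner R ν)
    (hμ : μ ∈ S.closedChamber) {w : Module.Dual ℝ 𝔥 ≃ₗ[ℝ] Module.Dual ℝ 𝔥}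
    (hw : w ∈ S.weylGroup) (hwμ : IsInner R (w μ)) : IsInner R μ := by
  obtain ⟨l, rfl⟩ := S.exists_word_of_mem_weylGroup hw
  clear hw
  induction hn : l.length using Nat.strong_induction_on generalizing l with
  | _ n ih =>
    match l with
    | [] => exact hwμ
    | i :: l =>
      have hcons : S.σ i * S.wordProd (i :: l) = S.wordProd l := by
        rw [wordProd_cons, ← mul_assoc, σ_mul_self, one_mul]
      rcases hS.pos_or_neg (S.wordProd_mem_weylGroup (i :: l)) i with h | h
      · obtain ⟨l', h1, h3⟩ := hS.exchange i l fun μ hμ => by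
          have := h μ hμ
          rw [wordProd_cons, LinearEquiv.mul_apply, σ_apply_h] at this
          linarith
        rw [← wordProd_cons] at h3
        simp only [List.length_cons] at hn
        exact ih l'.length (by omega) l' (h3 ▸ hwμ) rfl
      · have h0 := hS.apply_nonpos h hμ
        have hνi := hν i
        obtain ⟨q, hq, hqi⟩ : ∃ q, IsInner R q ∧ q (S.h i) = 0 := by
          rcases h0.lt_or_eq with hlt | heq
          · refine ⟨(-(S.wordProd (i :: l) μ) (S.h i)) • ν + ν (S.h i) • S.wordProd (i :: l) μ,
              (hνR.smul (neg_pos.2 hlt)).add (PointedCone.smul_mem R hνi hwμ.1), ?_⟩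
            simp only [LinearMap.add_apply, LinearMap.smul_apply, smul_eq_mul]
            ring
          · exact ⟨_, hwμ, heq⟩
        have hR' := S.map_eq_of_apply_eq hY hR (S.σ_mem_weylGroup i) hq
          ((S.σ_apply_eq_self_iff i q).2 hqi)
        have h1 := hwμ.map (S.σ i).toLinearMap
        rw [hR'] at h1
        have h2 : IsInner R (S.wordProd l μ) := by
          rw [← hcons]
          exact h1
        exact ih l.length (by simp [← hn]) l h2 rfl

end IsLinearCoxeterSystem
end RayFamily

/-! ### Generalized Cartan matrices of positive type -/

/-- Sign and magnitude conditions on the entries of the matrix of a linear Coxeter system. -/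
structure IsCoxeterCartan {I : Type*} (A : Matrix I I ℝ) : Prop where
  diag : ∀ i, A i i = 2
  nonpos : ∀ i j, i ≠ j → A i j ≤ 0
  one_le_mul : ∀ i j, i ≠ j → A i j ≠ 0 → 1 ≤ A i j * A j i

/-- There is a positive vector on `K` which is mapped to a positive vector by the submatrix
of `A` indexed by `K`. -/
def IsPositiveOn {I : Type*} (A : Matrix I I ℝ) (K : Finset I) : Prop :=
  ∃ u : I → ℝ, (∀ k ∈ K, 0 < u k) ∧ ∀ k ∈ K, 0 < ∑ j ∈ K, A k j * u j

namespace IsCoxeterCartan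

variable {I : Type*} {A : Matrix I I ℝ}

theorem ne_zero_symm (hA : IsCoxeterCartan A) {i j : I} (h : A i j ≠ 0) : A j i ≠ 0 := by
  rcases eq_or_ne i j with rfl | hij
  · exact h
  · intro h0
    have := hA.one_le_mul i j hij h
    rw [h0] at this
    norm_num at this

theorem isPositiveOn_mono (hA : IsCoxeterCartan A) {K L : Finset I} (hKL : K ⊆ L)
    (hL : IsPositiveOn A L) : IsPositiveOn A K := by
  classical
  obtain ⟨u, hu, hAu⟩ := hL
  refine ⟨u, fun k hk => hu k (hKL hk), fun k hk => (hAu k (hKL hk)).trans_le ?_⟩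
  rw [← Finset.sum_sdiff hKL]
  have : ∑ j ∈ L \ K, A k j * u j ≤ 0 := Finset.sum_nonpos fun j hj => by
    rw [Finset.mem_sdiff] at hj
    exact mul_nonpos_of_nonpos_of_nonneg (hA.nonpos k j fun h => hj.2 (h ▸ hk)) (hu j hj.1).le
  linarith

/-- A minimum principle: at an index where `v k / u k` is minimal and negative, nonpositivity off
the diagonal bounds the row of `A v` by that quotient times the positive row of `A u`. -/
theorem nonneg_of_mulVec_nonneg (hA : IsCoxeterCartan A) {K : Finset I} (hK : IsPositiveOn A K)
    {v : I → ℝ} (hv : ∀ k ∈ K, 0 ≤ ∑ j ∈ K, A k j * v j) : ∀ k ∈ K, 0 ≤ v k := by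
  obtain ⟨u, hu, hAu⟩ := hK
  intro l hl
  by_contra! hlt
  obtain ⟨k, hk, hmin⟩ := K.exists_min_image (fun k => v k / u k) ⟨l, hl⟩
  have hm : v k / u k < 0 := (hmin l hl).trans_lt (div_neg_of_neg_of_pos hlt (hu l hl))
  have h1 : ∑ j ∈ K, A k j * v j ≤ (v k / u k) * ∑ j ∈ K, A k j * u j := by
    rw [Finset.mul_sum]
    refine Finset.sum_le_sum fun j hj => ?_
    rcases eq_or_ne k j with rfl | hkj
    · have := (hu k hk).ne'
      apply le_of_eq
      field_simp
    · have h2 := (le_div_iff₀ (hu j hj)).1 (hmin j hj)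
      have := mul_le_mul_of_nonpos_left h2 (hA.nonpos k j hkj)
      linarith
  have := mul_neg_of_neg_of_pos hm (hAu k hk)
  linarith [hv k hk]

/-- The Dynkin graph has a vertex with at most one neighbour. The rescaled entries `A i j * u j / u
i` have positive row sums, while each edge contributes at most `-2` to a symmetrized pair because
the product of its entries is at least one. Two neighbours everywhere would cancel the diagonal
contribution `4`. -/
theorem exists_card_le_one [DecidableEq I] (hA : IsCoxeterCartan A) {K : Finset I}
    (hne : K.Nonempty) (hK : IsPositiveOn A K) :
    ∃ i ∈ K, (K.filter fun j => j ≠ i ∧ A i j ≠ 0).card ≤ 1 := by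
  obtain ⟨u, hu, hAu⟩ := hK
  by_contra! hc
  let M : I → I → ℝ := fun i j => A i j * u j / u i
  have hpos : 0 < ∑ i ∈ K, ∑ j ∈ K, M i j := by
    refine Finset.sum_pos (fun i hi => ?_) hne
    rw [← Finset.sum_div]
    exact div_pos (hAu i hi) (hu i hi)
  have hM : ∀ i ∈ K, ∀ j ∈ K, M i j + M j i ≤
      (if j = i then 4 else 0) + (if j ≠ i ∧ A i j ≠ 0 then -2 else 0) := by
    intro i hi j hj
    have hui := hu i hi
    have huj := hu j hj
    rcases eq_or_ne j i with rfl | hji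
    · simp only [M, hA.diag]
      field_simp
      norm_num
    · by_cases h0 : A i j = 0
      · have h0' : A j i = 0 := by
          by_contra h; exact hA.ne_zero_symm h h0
        simp [M, h0, h0', hji]
      · simp only [hji, if_false, zero_add, ne_eq, not_false_eq_true, h0, and_self, if_true]
        have h1 := hA.one_le_mul i j hji.symm h0
        have h2 : M i j * M j i = A i j * A j i := by
          simp only [M]; field_simp
        have h3 : M i j ≤ 0 := div_nonpos_of_nonpos_of_nonneg
          (mul_nonpos_of_nonpos_of_nonneg (hA.nonpos i j hji.symm) huj.le) hui.le
        have h4 : M j i ≤ 0 := div_nonpos_of_nonpos_of_nonneg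
          (mul_nonpos_of_nonpos_of_nonneg (hA.nonpos j i hji) hui.le) huj.le
        nlinarith [sq_nonneg (M i j - M j i)]
  have h2 : ∑ i ∈ K, ∑ j ∈ K, (M i j + M j i) ≤ 0 := by
    refine Finset.sum_nonpos fun i hi => (Finset.sum_le_sum (hM i hi)).trans ?_
    rw [Finset.sum_add_distrib, Finset.sum_ite_eq' K i, if_pos hi, ← Finset.sum_filter,
      Finset.sum_const, nsmul_eq_mul]
    have : (2 : ℝ) ≤ (K.filter fun j => j ≠ i ∧ A i j ≠ 0).card := by exact_mod_cast hc i hi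
    linarith
  simp only [Finset.sum_add_distrib] at h2
  rw [Finset.sum_comm (f := fun i j => M j i)] at h2
  linarith

/-- Removing a vertex with at most one neighbour and symmetrizing the rest leaves at most one
equation for the weight of the removed vertex. -/
theorem exists_symmetrizer (hA : IsCoxeterCartan A) (K : Finset I) (hK : IsPositiveOn A K) :
    ∃ d : I → ℝ, (∀ i, 0 < d i) ∧ ∀ i ∈ K, ∀ j ∈ K, d i * A i j = d j * A j i := by
  classical
  induction hn : K.card generalizing K with
  | zero =>
    rw [Finset.card_eq_zero] at hn
    exact ⟨fun _ => 1, fun _ => one_pos, by simp [hn]⟩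
  | succ n ih =>
    obtain ⟨i, hi, hcard⟩ := hA.exists_card_le_one (Finset.card_pos.1 (by omega)) hK
    obtain ⟨d, hd, hsymm⟩ := ih (K.erase i) (hA.isPositiveOn_mono (K.erase_subset i) hK)
      (by rw [Finset.card_erase_of_mem hi]; omega)
    rw [Finset.card_le_one_iff] at hcard
    obtain ⟨t, ht, htj⟩ : ∃ t : ℝ, 0 < t ∧ ∀ j ∈ K, j ≠ i → t * A i j = d j * A j i := by
      by_cases h : ∃ k ∈ K, k ≠ i ∧ A i k ≠ 0
      · obtain ⟨k, hk, hki, hk0⟩ := h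
        have hk0' := hA.ne_zero_symm hk0
        have h1 := lt_of_le_of_ne (hA.nonpos i k hki.symm) hk0
        have h2 := lt_of_le_of_ne (hA.nonpos k i hki) hk0'
        refine ⟨d k * (A k i / A i k), mul_pos (hd k) (div_pos_of_neg_of_neg h2 h1), ?_⟩
        intro j hj hji
        by_cases hj0 : A i j = 0
        · have : A j i = 0 := by
            by_contra h; exact hA.ne_zero_symm h hj0
          rw [hj0, this]; simp
        · have : j = k := hcard (by simp [hj, hji, hj0]) (by simp [hk, hki, hk0])
          subst this
          field_simp
      · push Not at h
        refine ⟨1, one_pos, fun j hj hji => ?_⟩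
        have hj0 := h j hj hji
        have : A j i = 0 := by
          by_contra h; exact hA.ne_zero_symm h hj0
        rw [hj0, this]; simp
    refine ⟨Function.update d i t, fun j => ?_, fun j hj k hk => ?_⟩
    · rcases eq_or_ne j i with rfl | hji
      · simpa using ht
      · simpa [hji] using hd j
    · rcases eq_or_ne j i with hji | hji <;> rcases eq_or_ne k i with hki | hki
      · rw [hji, hki]
      · simpa [hji, hki] using htj k hk hki
      · simpa [hji, hki] using (htj j hj hji).symm
      · simpa [hji, hki] using hsymm j (by simp [hj, hji]) k (by simp [hk, hki])

/-- With `y i = x i / u i`, the form equals `∑ r i * x i ^ 2` minus half of `∑ c i j * (y i - y j) ^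
2`, and the off-diagonal `c i j` are nonpositive. Thus the form is positive definite. -/
theorem exists_quadratic_bound (hA : IsCoxeterCartan A) {K : Finset I} (hK : IsPositiveOn A K)
    {d : I → ℝ} (hd : ∀ i, 0 < d i) (hsymm : ∀ i ∈ K, ∀ j ∈ K, d i * A i j = d j * A j i) :
    ∃ r : ℝ, 0 < r ∧ ∀ x : I → ℝ, ∀ i ∈ K,
      r * x i ^ 2 ≤ ∑ i ∈ K, ∑ j ∈ K, x i * (d i * A i j * x j) := by
  obtain ⟨u, hu, hAu⟩ := hK
  let r : I → ℝ := fun i => d i * (∑ j ∈ K, A i j * u j) / u i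
  have hr : ∀ i ∈ K, 0 < r i := fun i hi => div_pos (mul_pos (hd i) (hAu i hi)) (hu i hi)
  have key : ∀ x : I → ℝ,
      ∑ i ∈ K, r i * x i ^ 2 ≤ ∑ i ∈ K, ∑ j ∈ K, x i * (d i * A i j * x j) := by
    intro x
    let c : I → I → ℝ := fun i j => d i * A i j * u i * u j
    let y : I → ℝ := fun i => x i / u i
    have h1 : ∑ i ∈ K, r i * x i ^ 2 = ∑ i ∈ K, ∑ j ∈ K, c i j * y i ^ 2 := by
      refine Finset.sum_congr rfl fun i hi => ?_
      have := (hu i hi).ne'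
      simp only [r, c, y, Finset.mul_sum, Finset.sum_div, Finset.sum_mul]
      refine Finset.sum_congr rfl fun j hj => ?_
      field_simp
    have h1' : ∑ i ∈ K, r i * x i ^ 2 = ∑ i ∈ K, ∑ j ∈ K, c i j * y j ^ 2 := by
      rw [h1, Finset.sum_comm]
      refine Finset.sum_congr rfl fun i hi => Finset.sum_congr rfl fun j hj => ?_
      have := hsymm i hi j hj
      simp only [c, ← this]
      ring
    have h2 : ∑ i ∈ K, ∑ j ∈ K, x i * (d i * A i j * x j) =
        ∑ i ∈ K, ∑ j ∈ K, c i j * (y i * y j) := by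
      refine Finset.sum_congr rfl fun i hi => Finset.sum_congr rfl fun j hj => ?_
      have := (hu i hi).ne'
      have := (hu j hj).ne'
      simp only [c, y]
      field_simp
    have h3 : ∑ i ∈ K, ∑ j ∈ K, c i j * (y i - y j) ^ 2 ≤ 0 := by
      refine Finset.sum_nonpos fun i hi => Finset.sum_nonpos fun j hj => ?_
      rcases eq_or_ne i j with rfl | hij
      · simp
      · refine mul_nonpos_of_nonpos_of_nonneg ?_ (sq_nonneg _)
        exact mul_nonpos_of_nonpos_of_nonneg (mul_nonpos_of_nonpos_of_nonneg
          (mul_nonpos_of_nonneg_of_nonpos (hd i).le (hA.nonpos i j hij)) (hu i hi).le) (hu j hj).le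
    have h4 : ∑ i ∈ K, ∑ j ∈ K, c i j * (y i - y j) ^ 2 =
        ∑ i ∈ K, ∑ j ∈ K, c i j * y i ^ 2 + ∑ i ∈ K, ∑ j ∈ K, c i j * y j ^ 2
          - 2 * ∑ i ∈ K, ∑ j ∈ K, c i j * (y i * y j) := by
      simp only [Finset.mul_sum, ← Finset.sum_add_distrib, ← Finset.sum_sub_distrib]
      refine Finset.sum_congr rfl fun i hi => Finset.sum_congr rfl fun j hj => ?_
      ring
    rw [h2]
    linarith
  rcases K.eq_empty_or_nonempty with rfl | hne
  · exact ⟨1, one_pos, by simp⟩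
  obtain ⟨m, hm, hmin⟩ := K.exists_min_image r hne
  refine ⟨r m, hr m hm, fun x i hi => le_trans ?_ (key x)⟩
  refine (mul_le_mul_of_nonneg_right (hmin i hi) (sq_nonneg _)).trans ?_
  exact Finset.single_le_sum (f := fun i => r i * x i ^ 2)
    (fun j hj => mul_nonneg (hr j hj).le (sq_nonneg _)) hi

end IsCoxeterCartan

/-! ### The matrix of a linear Coxeter system and finiteness of parabolic subgroups of positive type
-/

namespace RayFamily

variable {I 𝔥 : Type*} [AddCommGroup 𝔥] [Module ℝ 𝔥] {S : RayFamily I 𝔥}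

theorem cartanMatrix_apply (S : RayFamily I 𝔥) (i j : I) : S.cartanMatrix i j = S.α j (S.h i) :=
  rfl

theorem IsLinearCoxeterSystem.isCoxeterCartan [Fintype I] [FiniteDimensional ℝ 𝔥]
    (hS : S.IsLinearCoxeterSystem) : IsCoxeterCartan S.cartanMatrix := by
  choose p hp0 hp using hS.exists_mem_wall
  have hpC : ∀ i, p i ∈ S.closedChamber := fun i j => by
    rcases eq_or_ne j i with rfl | h
    · exact (hp0 j).ge
    · exact (hp i j h).le
  have hnonpos : ∀ i j, i ≠ j → S.α j (S.h i) ≤ 0 := by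
    intro i j hij
    rcases hS.pos_or_neg (S.σ_mem_weylGroup j) i with h | h
    · have h1 := hS.apply_nonneg h (hpC i)
      have h2 := hp i j hij.symm
      rw [σ_apply] at h1
      simp only [LinearMap.sub_apply, LinearMap.smul_apply, smul_eq_mul, hp0, zero_sub] at h1
      by_contra! h3
      linarith [mul_pos h2 h3]
    · have h1 := hS.apply_nonpos h (hpC j)
      rw [(S.σ_apply_eq_self_iff j _).2 (hp0 j)] at h1
      linarith [hp j i hij]
  have hmul : ∀ i j, i ≠ j → S.α i (S.h j) ≠ 0 → 1 ≤ S.α j (S.h i) * S.α i (S.h j) := by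
    intro i j hij h0
    by_contra! hlt
    have ha := lt_of_le_of_ne (hnonpos j i hij.symm) h0
    -- If the product were below one, this functional would be negative at `p i` and positive at `p
    -- j`, although it has constant sign on the closed chamber.
    have hform : ∀ x : Module.Dual ℝ 𝔥, ((S.σ i * S.σ j) x) (S.h j) =
        (S.α j (S.h i) * S.α i (S.h j) - 1) * x (S.h j) - S.α i (S.h j) * x (S.h i) := by
      intro x
      rw [LinearEquiv.mul_apply, S.σ_apply i, LinearMap.sub_apply, σ_apply_h, S.σ_apply j]
      simp only [LinearMap.sub_apply, LinearMap.smul_apply, smul_eq_mul]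
      ring
    have h1 := hform (p i)
    have h2 := hform (p j)
    have hij' := hp i j hij.symm
    have hji' := hp j i hij
    rw [hp0] at h1 h2
    rcases hS.pos_or_neg (mul_mem (S.σ_mem_weylGroup i) (S.σ_mem_weylGroup j)) j with h | h
    · have := hS.apply_nonneg h (hpC i)
      nlinarith
    · have := hS.apply_nonpos h (hpC j)
      nlinarith
  exact ⟨S.α_h, hnonpos, fun i j hij h0 => by
    rw [mul_comm]; exact hmul j i hij.symm h0⟩

/-- Elements of a parabolic subgroup of positive type act on the coordinates with respect to the
`α k` by isometries of the symmetrized form. -/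
theorem exists_coordinate_isometry {K : Finset I} {d : I → ℝ}
    (hsymm : ∀ i ∈ K, ∀ j ∈ K, d i * S.cartanMatrix i j = d j * S.cartanMatrix j i)
    {w : Module.Dual ℝ 𝔥 ≃ₗ[ℝ] Module.Dual ℝ 𝔥} (hw : w ∈ S.parabolic (K : Set I)) :
    ∃ g : (K → ℝ) ≃ₗ[ℝ] (K → ℝ),
      (∀ c, g c ⬝ᵥ (Matrix.of fun i j : K => d i * S.cartanMatrix i j).mulVec (g c) =
        c ⬝ᵥ (Matrix.of fun i j : K => d i * S.cartanMatrix i j).mulVec c) ∧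
      ∀ c, Fintype.linearCombination ℝ (fun k : K => S.α k) (g c) =
        w (Fintype.linearCombination ℝ (fun k : K => S.α k) c) := by
  classical
  set M : Matrix K K ℝ := Matrix.of fun i j : K => d i * S.cartanMatrix i j with hM
  set π := Fintype.linearCombination ℝ (fun k : K => S.α k) with hπ
  have hMπ : ∀ c k, M.mulVec c k = d k * (π c) (S.h k) := by
    intro c k
    simp only [hM, hπ, Matrix.mulVec, dotProduct, Matrix.of_apply, Fintype.linearCombination_apply,
      LinearMap.sum_apply, LinearMap.smul_apply, smul_eq_mul, cartanMatrix_apply, Finset.mul_sum]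
    exact Finset.sum_congr rfl fun j _ => by ring
  have hπe : ∀ k : K, π (Pi.single k 1) = S.α k := fun k => by
    simp [hπ, Fintype.linearCombination_apply_single]
  have hMsymm : ∀ x y : K → ℝ, x ⬝ᵥ M.mulVec y = y ⬝ᵥ M.mulVec x := by
    intro x y
    have : M.transpose = M := by
      ext i j
      exact hsymm j j.2 i i.2
    rw [Matrix.dotProduct_mulVec, ← Matrix.mulVec_transpose, this, dotProduct_comm]
  induction hw using Subgroup.closure_induction with
  | mem x hx =>
    obtain ⟨k, hk, rfl⟩ := hx
    let k' : K := ⟨k, hk⟩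
    -- The `α k` are not assumed linearly independent, so the reflection is lifted to the coordinate
    -- space, where `π` intertwines the lift with `σ k`.
    let f : Module.Dual ℝ (K → ℝ) := (Module.Dual.eval ℝ 𝔥 (S.h k)).comp π
    have hf : f (Pi.single k' 1) = 2 := by
      change (π (Pi.single k' 1)) (S.h k) = 2
      rw [hπe]
      exact S.α_h k
    have hg : ∀ c, Module.reflection hf c = c - (π c) (S.h k) • Pi.single k' 1 := fun c => rfl
    refine ⟨Module.reflection hf, fun c => ?_, fun c => ?_⟩
    · rw [hg]
      have h1 : ∀ v : K → ℝ, Pi.single k' (1 : ℝ) ⬝ᵥ M.mulVec v = d k * (π v) (S.h k) := fun v => by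
        rw [single_one_dotProduct, hMπ]
      simp only [Matrix.mulVec_sub, Matrix.mulVec_smul, dotProduct_sub, sub_dotProduct,
        smul_dotProduct, dotProduct_smul, smul_eq_mul, h1, hMsymm c (Pi.single k' 1), hπe]
      rw [S.α_h]
      ring
    · rw [hg, map_sub, map_smul, hπe]
      rfl
  | one => exact ⟨1, fun _ => rfl, fun _ => rfl⟩
  | mul x y _ _ hx hy =>
    obtain ⟨g, hg, hg'⟩ := hx
    obtain ⟨g₂, hg₂, hg₂'⟩ := hy
    refine ⟨g * g₂, fun c => ?_, fun c => ?_⟩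
    · rw [LinearEquiv.mul_apply, hg, hg₂]
    · rw [LinearEquiv.mul_apply, LinearEquiv.mul_apply, hg', hg₂']
  | inv x _ hx =>
    obtain ⟨g, hg, hg'⟩ := hx
    refine ⟨g⁻¹, fun c => ?_, fun c => ?_⟩
    · have h1 : g (g⁻¹ c) = c := g.apply_symm_apply c
      rw [← hg, h1]
    · have h1 : g (g⁻¹ c) = c := g.apply_symm_apply c
      have h2 := hg' (g⁻¹ c)
      rw [h1] at h2
      rw [h2]
      exact (x.symm_apply_apply _).symm

/-- The group acts on coordinates by isometries of a positive definite form, so an orbit is bounded.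
Disjointness of chambers makes a suitable orbit uniformly separated, and compactness then makes it
finite. -/
theorem IsLinearCoxeterSystem.finite_parabolic [Fintype I] [FiniteDimensional ℝ 𝔥]
    (hS : S.IsLinearCoxeterSystem) {K : Finset I} (hK : IsPositiveOn S.cartanMatrix K) :
    (S.parabolic (K : Set I) : Set (Module.Dual ℝ 𝔥 ≃ₗ[ℝ] Module.Dual ℝ 𝔥)).Finite := by
  classical
  have hA := hS.isCoxeterCartan
  obtain ⟨d, hd, hsymm⟩ := hA.exists_symmetrizer K hK
  obtain ⟨r, hr, hbound⟩ := hA.exists_quadratic_bound hK hd hsymm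
  have hiso := fun w (hw : w ∈ S.parabolic (K : Set I)) => exists_coordinate_isometry hsymm hw
  set M : Matrix K K ℝ := Matrix.of fun i j : K => d i * S.cartanMatrix i j with hM
  set π := Fintype.linearCombination ℝ (fun k : K => S.α k) with hπ
  choose! g hgq hgπ using hiso
  let q : (K → ℝ) → ℝ := fun c => c ⬝ᵥ M.mulVec c
  have hq : ∀ (c : K → ℝ) (i : K), r * c i ^ 2 ≤ q c := by
    intro c i
    have h := hbound (Function.extend Subtype.val c 0) i i.2
    have hx : ∀ j : K, Function.extend Subtype.val c 0 (j : I) = c j :=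
      fun j => Subtype.val_injective.extend_apply _ _ j
    simp only [← Finset.sum_coe_sort K, hx] at h
    simpa only [q, dotProduct, Matrix.mulVec, hM, Matrix.of_apply, Finset.mul_sum] using h
  have hqc : Continuous q := by
    simp only [q, dotProduct, Matrix.mulVec]
    fun_prop
  obtain ⟨ρ, hρ⟩ := hS.exists_mem_openChamber
  -- Definiteness makes the coordinates of a point agreeing with `ρ` on all `h k`, `k ∈ K`,
  -- solvable. The remainder `ρ - π c₀` is then fixed by the parabolic subgroup, so `w ρ` is
  -- controlled by the orbit of `c₀`.
  obtain ⟨c₀, hc₀⟩ : ∃ c₀ : K → ℝ, ∀ k ∈ K, (π c₀) (S.h k) = ρ (S.h k) := by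
    let T : (K → ℝ) →ₗ[ℝ] (K → ℝ) := LinearMap.pi fun k => (Module.Dual.eval ℝ 𝔥 (S.h k)).comp π
    have hT : Function.Injective T := by
      rw [← LinearMap.ker_eq_bot, LinearMap.ker_eq_bot']
      intro c hc
      have hc' : ∀ k : K, (π c) (S.h k) = 0 := fun k => congrFun hc k
      have hMc : M.mulVec c = 0 := by
        ext k
        have := hc' k
        simp only [hπ, Fintype.linearCombination_apply, LinearMap.sum_apply, LinearMap.smul_apply,
          smul_eq_mul] at this
        simp only [hM, Matrix.mulVec, dotProduct, Matrix.of_apply, cartanMatrix_apply, mul_assoc,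
          ← Finset.mul_sum]
        simp only [mul_comm (S.α _ _), this, mul_zero, Pi.zero_apply]
      ext i
      have := hq c i
      simp only [q, hMc, dotProduct_zero] at this
      have : c i ^ 2 = 0 := le_antisymm (by by_contra! h; linarith [mul_pos hr h]) (sq_nonneg _)
      simpa using this
    obtain ⟨c, hc⟩ := LinearMap.injective_iff_surjective.1 hT fun k => ρ (S.h k)
    exact ⟨c, fun k hk => congrFun hc ⟨k, hk⟩⟩
  have hfix : ∀ w ∈ S.parabolic (K : Set I), w ρ = w (π c₀) + (ρ - π c₀) := by
    intro w hw
    have h1 := S.parabolic_apply_eq_self hw (μ := ρ - π c₀) fun k hk => by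
      simp [hc₀ k hk]
    calc w ρ = w (π c₀ + (ρ - π c₀)) := by rw [add_sub_cancel]
      _ = _ := by rw [map_add, h1]
  obtain ⟨δ, hδ, hδ'⟩ : ∃ δ : ℝ, 0 < δ ∧ ∀ c, q c < δ → π c + ρ ∈ S.openChamber := by
    have hopen : IsOpen {c : K → ℝ | π c + ρ ∈ S.openChamber} := by
      have : {c : K → ℝ | π c + ρ ∈ S.openChamber} =
          ⋂ i, {c : K → ℝ | 0 < (π c) (S.h i) + ρ (S.h i)} := by
        ext c; simp [mem_openChamber]
      rw [this]
      refine isOpen_iInter_of_finite fun i => isOpen_lt continuous_const ?_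
      refine Continuous.add ?_ continuous_const
      exact ((Module.Dual.eval ℝ 𝔥 (S.h i)).comp π).continuous_of_finiteDimensional
    obtain ⟨ε, hε, hball⟩ := Metric.isOpen_iff.1 hopen 0 (by simpa using hρ)
    refine ⟨r * ε ^ 2, by positivity, fun c hc => hball ?_⟩
    rw [mem_ball_zero_iff, pi_norm_lt_iff hε]
    intro i
    have h1 : c i ^ 2 < ε ^ 2 := lt_of_mul_lt_mul_left ((hq c i).trans_lt hc) hr.le
    exact abs_lt_of_sq_lt_sq h1 hε.le
  by_contra hinf
  have hsep : ∀ w ∈ S.parabolic (K : Set I), ∀ w' ∈ S.parabolic (K : Set I),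
      q (g w' c₀ - g w c₀) < δ → w = w' := by
    intro w hw w' hw' hlt
    have h1 : g w ((g w).symm (g w' c₀ - g w c₀)) = g w' c₀ - g w c₀ :=
      (g w).apply_symm_apply _
    have h2 : q ((g w).symm (g w' c₀ - g w c₀)) < δ := by
      have := hgq w hw ((g w).symm (g w' c₀ - g w c₀))
      rw [h1] at this
      simpa only [q, ← this] using hlt
    have h3 := hδ' _ h2
    have h4 : w (π ((g w).symm (g w' c₀ - g w c₀)) + ρ) = w' ρ := by
      rw [map_add, ← hgπ w hw, h1, map_sub, hgπ w hw, hgπ w' hw', hfix w hw, hfix w' hw']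
      abel
    have h5 : (w⁻¹ * w') ρ = π ((g w).symm (g w' c₀ - g w c₀)) + ρ := by
      rw [LinearEquiv.mul_apply, ← h4]
      exact w.symm_apply_apply _
    have h6 := hS.eq_one_of_mem (S.parabolic_le _ (mul_mem (inv_mem hw) hw')) hρ (h5 ▸ h3)
    exact inv_mul_eq_one.1 h6
  have hq0 : q 0 = 0 := by simp [q]
  have hinj : Set.InjOn (fun w => g w c₀) (S.parabolic (K : Set I) : Set _) := by
    intro w hw w' hw' h
    refine hsep w hw w' hw' ?_
    simp only at h
    rw [h, sub_self, hq0]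
    exact hδ
  have hinf' := (Set.infinite_image_iff hinj).2 hinf
  have hcomp : IsCompact {c | q c ≤ q c₀} := by
    refine Metric.isCompact_of_isClosed_isBounded (isClosed_le hqc continuous_const) ?_
    refine (Metric.isBounded_closedBall (x := (0 : K → ℝ)) (r := √(q c₀ / r))).subset ?_
    intro c hc
    rw [mem_closedBall_zero_iff, pi_norm_le_iff_of_nonneg (Real.sqrt_nonneg _)]
    intro i
    refine Real.abs_le_sqrt ?_
    rw [le_div_iff₀ hr]
    have := hq c i
    have hc' : q c ≤ q c₀ := hc
    linarith
  obtain ⟨z, -, hz⟩ := hinf'.exists_accPt_of_subset_isCompact hcomp (by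
    rintro _ ⟨w, hw, rfl⟩
    exact (hgq w hw c₀).le)
  -- Two different orbit points close to the accumulation point `z` would violate the separation
  -- `hsep`.
  have hnhds : ∀ᶠ p : (K → ℝ) × (K → ℝ) in nhds (z, z), q (p.1 - p.2) < δ := by
    have : Continuous fun p : (K → ℝ) × (K → ℝ) => q (p.1 - p.2) := by fun_prop
    refine this.continuousAt.eventually_lt continuousAt_const ?_
    simpa [hq0] using hδ
  rw [nhds_prod_eq, Filter.eventually_prod_iff] at hnhds
  obtain ⟨p₁, hp₁, p₂, hp₂, hpq⟩ := hnhds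
  have hU := hp₁.and hp₂
  obtain ⟨x, hx, hxz, ⟨w, hw, rfl⟩⟩ : ∃ x, (p₁ x ∧ p₂ x) ∧ x ≠ z ∧
      x ∈ (fun w => g w c₀) '' (S.parabolic (K : Set I) : Set _) := by
    obtain ⟨x, ⟨h1, h2⟩, h3⟩ := accPt_iff_nhds.1 hz _ hU
    exact ⟨x, h1, h3, h2⟩
  obtain ⟨y, hy, hyz, ⟨w', hw', rfl⟩⟩ : ∃ y, ((p₁ y ∧ p₂ y) ∧ y ≠ g w c₀) ∧ y ≠ z ∧
      y ∈ (fun w => g w c₀) '' (S.parabolic (K : Set I) : Set _) := by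
    have hne : ∀ᶠ y in nhds z, y ≠ g w c₀ := isOpen_ne.mem_nhds (Ne.symm hxz)
    obtain ⟨y, ⟨h1, h2⟩, h3⟩ := accPt_iff_nhds.1 hz _ (hU.and hne)
    exact ⟨y, h1, h3, h2⟩
  have := hsep w hw w' hw' (hpq hy.1.1 hx.2)
  subst this
  exact hy.2 rfl

end RayFamily

/-! ### Connected components and their types -/

namespace RayFamily

variable {I 𝔥 : Type*} [AddCommGroup 𝔥] [Module ℝ 𝔥]

/-- The connected component of `i` in `J`. -/
def comp (S : RayFamily I 𝔥) (J : Set I) (i : I) : Set I :=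
  {k | Relation.ReflTransGen (fun a b => b ∈ J ∧ S.coxeterGraph.Adj a b) i k}

variable {S : RayFamily I 𝔥} {J K : Set I} {i j k : I}

theorem mem_comp_self : i ∈ S.comp J i := Relation.ReflTransGen.refl

theorem comp_subset (hi : i ∈ J) : S.comp J i ⊆ J := by
  intro k hk
  induction hk with
  | refl => exact hi
  | tail _ h _ => exact h.1

theorem mem_comp_symm (hi : i ∈ J) (h : k ∈ S.comp J i) : i ∈ S.comp J k := by
  induction h with
  | refl => exact Relation.ReflTransGen.refl
  | tail h1 h2 ih =>
    exact Relation.ReflTransGen.head ⟨comp_subset hi h1, h2.2.symm⟩ ih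

theorem comp_eq (hi : i ∈ J) (h : k ∈ S.comp J i) : S.comp J k = S.comp J i :=
  Set.Subset.antisymm (fun _ hl => Relation.ReflTransGen.trans h hl)
    fun _ hl => Relation.ReflTransGen.trans (mem_comp_symm hi h) hl

theorem comp_mono (h : J ⊆ K) : S.comp J i ⊆ S.comp K i :=
  fun _ hk => Relation.ReflTransGen.mono (r := fun a b => b ∈ J ∧ S.coxeterGraph.Adj a b)
    (p := fun a b => b ∈ K ∧ S.coxeterGraph.Adj a b) (fun _ _ hab => ⟨h hab.1, hab.2⟩) _ _ hk

theorem mem_comp_of_adj (h : k ∈ S.comp J i) (hj : j ∈ J) (hkj : S.coxeterGraph.Adj k j) :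
    j ∈ S.comp J i :=
  Relation.ReflTransGen.tail h ⟨hj, hkj⟩

theorem adj_iff : S.coxeterGraph.Adj j k ↔
    j ≠ k ∧ (S.cartanMatrix j k ≠ 0 ∨ S.cartanMatrix k j ≠ 0) :=
  SimpleGraph.fromRel_adj _ _ _

theorem cartanMatrix_eq_zero_of_notMem_comp (hk : k ∈ S.comp J i) (hj : j ∈ J)
    (hji : j ∉ S.comp J i) : S.cartanMatrix k j = 0 ∧ S.cartanMatrix j k = 0 := by
  have h : ¬ S.coxeterGraph.Adj k j := fun h => hji (mem_comp_of_adj hk hj h)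
  rw [adj_iff] at h
  have hne : k ≠ j := by
    rintro rfl
    exact hji hk
  tauto

theorem reachable_iff (hi : i ∈ J) (hk : k ∈ J) :
    (S.coxeterGraph.induce J).Reachable ⟨i, hi⟩ ⟨k, hk⟩ ↔ k ∈ S.comp J i := by
  rw [SimpleGraph.reachable_iff_reflTransGen]
  constructor
  · intro h
    exact Relation.ReflTransGen.lift (p := fun a b => b ∈ J ∧ S.coxeterGraph.Adj a b) Subtype.val
      (fun a b hab => ⟨b.2, hab⟩) _ _ h
  · intro h
    have hk' := hk
    induction h with
    | refl => exact Relation.ReflTransGen.refl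
    | @tail b c h1 h2 ih =>
      have hb := comp_subset hi h1
      exact Relation.ReflTransGen.tail (ih hb hb) h2.2

theorem isComponent_iff : S.IsComponent J K ↔ ∃ i ∈ J, K = S.comp J i := by
  have hsupp : ∀ (i : I) (hi : i ∈ J),
      Subtype.val '' ((S.coxeterGraph.induce J).connectedComponentMk ⟨i, hi⟩).supp =
        S.comp J i := by
    intro i hi
    ext k
    constructor
    · rintro ⟨⟨k, hk⟩, h, rfl⟩
      rw [SimpleGraph.ConnectedComponent.mem_supp_iff, SimpleGraph.ConnectedComponent.eq] at h
      exact (reachable_iff hi hk).1 h.symm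
    · intro h
      refine ⟨⟨k, comp_subset hi h⟩, ?_, rfl⟩
      rw [SimpleGraph.ConnectedComponent.mem_supp_iff, SimpleGraph.ConnectedComponent.eq]
      exact ((reachable_iff hi _).2 h).symm
  constructor
  · rintro ⟨c, rfl⟩
    induction c using SimpleGraph.ConnectedComponent.ind with
    | _ v => exact ⟨v, v.2, hsupp v v.2⟩
  · rintro ⟨i, hi, rfl⟩
    exact ⟨_, (hsupp i hi).symm⟩

theorem isFacial_zeroSet {μ : Module.Dual ℝ 𝔥} (hμ : μ ∈ S.closedChamber) :
    S.IsFacial {i | μ (S.h i) = 0} := by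
  have hnn : ∀ x ∈ PointedCone.hull ℝ (Set.range S.h), 0 ≤ μ x := by
    intro x hx
    induction hx using Submodule.span_induction with
    | mem x hx =>
      obtain ⟨i, rfl⟩ := hx
      exact hμ i
    | zero => simp
    | add x y _ _ hx hy => rw [map_add]; exact add_nonneg hx hy
    | smul a x _ hx =>
      have : μ (a • x) = (a : ℝ) * μ x := μ.map_smul (a : ℝ) x
      rw [this]
      exact mul_nonneg a.2 hx
  -- Since `μ` is nonnegative on the cone, its kernel cuts out an exposed face.
  refine ⟨PointedCone.hull ℝ (Set.range S.h) ⊓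
    PointedCone.ofSubmodule (LinearMap.ker μ), ⟨inf_le_left, ?_⟩, ?_⟩
  · rintro x y a hx hy ha ⟨-, hxy⟩
    refine ⟨hx, ?_⟩
    change μ (a • x + y) = 0 at hxy
    change μ x = 0
    rw [map_add, map_smul, smul_eq_mul] at hxy
    refine le_antisymm ?_ (hnn x hx)
    by_contra! hlt
    linarith [mul_pos ha hlt, hnn y hy]
  · ext i
    constructor
    · intro h
      exact ⟨Submodule.subset_span ⟨i, rfl⟩, h⟩
    · intro h
      exact h.2

variable [Fintype I]

theorem mem_infPart_iff : i ∈ S.infPart J ↔ i ∈ J ∧ ¬ S.IsFiniteType (S.comp J i) := by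
  simp only [infPart, Set.mem_iUnion, exists_prop, isComponent_iff]
  constructor
  · rintro ⟨_, ⟨⟨k, hk, rfl⟩, hfin⟩, hi⟩
    rw [comp_eq hk hi]
    exact ⟨comp_subset hk hi, hfin⟩
  · rintro ⟨hi, hfin⟩
    exact ⟨_, ⟨⟨i, hi, rfl⟩, hfin⟩, mem_comp_self⟩

theorem infPart_subset : S.infPart J ⊆ J := fun _ h => (mem_infPart_iff.1 h).1

open Classical in
theorem IsFiniteType.isPositiveOn (h : S.IsFiniteType K) :
    IsPositiveOn S.cartanMatrix K.toFinset := by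
  obtain ⟨-, ⟨u, hu, hAu⟩, -⟩ := h
  have hx : ∀ j : K, Function.extend Subtype.val u 0 (j : I) = u j :=
    fun j => Subtype.val_injective.extend_apply _ _ j
  have hsum : ∀ f : I → ℝ, ∑ j ∈ K.toFinset, f j = ∑ j : K, f j := fun f =>
    (Finset.sum_subtype _ (by simp) f)
  refine ⟨Function.extend Subtype.val u 0, fun k hk => ?_, fun k hk => ?_⟩ <;>
    rw [Set.mem_toFinset] at hk
  · rw [hx ⟨k, hk⟩]
    exact hu _
  · rw [hsum]
    simp only [hx]
    convert hAu ⟨k, hk⟩ using 1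
    simp only [Matrix.mulVec, dotProduct, Matrix.submatrix_apply]

-- Invertibility follows from the minimum principle applied to `v` and `-v`. Connectedness gives the
-- alternative `v > 0` or `v = 0`: a zero of a nonnegative `v` with `A v ≥ 0` spreads along edges.
open Classical in
theorem IsFiniteType.of_isPositiveOn (hA : IsCoxeterCartan S.cartanMatrix) (hi : i ∈ J)
    (h : IsPositiveOn S.cartanMatrix (S.comp J i).toFinset) : S.IsFiniteType (S.comp J i) := by
  set K := S.comp J i with hK
  have hsum : ∀ f : I → ℝ, ∑ j ∈ K.toFinset, f j = ∑ j : K, f j := fun f =>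
    (Finset.sum_subtype _ (by simp) f)
  have hext : ∀ (v : K → ℝ) (j : K), Function.extend Subtype.val v 0 (j : I) = v j :=
    fun v j => Subtype.val_injective.extend_apply _ _ j
  have hmul : ∀ (v : K → ℝ) (k : K),
      (S.cartanMatrix.submatrix (Subtype.val : K → I) (Subtype.val : K → I)).mulVec v k =
        ∑ j ∈ K.toFinset, S.cartanMatrix k j * Function.extend Subtype.val v 0 j := by
    intro v k
    rw [hsum]
    simp only [hext]
    rfl
  have hnonneg : ∀ v : K → ℝ, (∀ k, 0 ≤
      (S.cartanMatrix.submatrix (Subtype.val : K → I) (Subtype.val : K → I)).mulVec v k) →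
      ∀ k, 0 ≤ v k := by
    intro v hv k
    rw [← hext v k]
    refine hA.nonneg_of_mulVec_nonneg h (fun l hl => ?_) k (by simp)
    rw [← hmul v ⟨l, Set.mem_toFinset.1 hl⟩]
    exact hv _
  refine ⟨?_, ?_, ?_⟩
  · intro hdet
    obtain ⟨v, hv0, hv⟩ := Matrix.exists_mulVec_eq_zero_iff.2 hdet
    refine hv0 (funext fun k => le_antisymm ?_ ?_)
    · have := hnonneg (-v) (fun k => by rw [Matrix.mulVec_neg, hv]; simp) k
      simpa using this
    · exact hnonneg v (fun k => by rw [hv]; simp) k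
  · obtain ⟨u, hu, hAu⟩ := h
    refine ⟨fun k => u k, fun k => hu k (by simp), fun k => ?_⟩
    have := hAu k (by simp)
    rw [hsum] at this
    exact this
  · intro v hv
    have hv0 := hnonneg v hv
    by_cases hpos : ∀ k, 0 < v k
    · exact Or.inl hpos
    right
    push Not at hpos
    obtain ⟨k, hk⟩ := hpos
    have hk0 := le_antisymm hk (hv0 k)
    have hstep : ∀ k l : K, S.coxeterGraph.Adj k l → v k = 0 → v l = 0 := by
      intro k l hkl hvk
      have h1 : ∀ j : K, S.cartanMatrix k j * v j ≤ 0 := fun j => by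
        rcases eq_or_ne k j with rfl | hkj
        · simp [hvk]
        · exact mul_nonpos_of_nonpos_of_nonneg
            (hA.nonpos _ _ fun h => hkj (Subtype.ext h)) (hv0 j)
      have h2 : S.cartanMatrix k l * v l = 0 := by
        have h3 : ∑ j : K, S.cartanMatrix k j * v j = 0 :=
          le_antisymm (Finset.sum_nonpos fun j _ => h1 j) (hv k)
        exact (Finset.sum_eq_zero_iff_of_nonpos fun j _ => h1 j).1 h3 l (Finset.mem_univ l)
      have hne : S.cartanMatrix k l ≠ 0 := by
        rcases (adj_iff.1 hkl).2 with h | h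
        · exact h
        · exact hA.ne_zero_symm h
      exact (mul_eq_zero.1 h2).resolve_left hne
    have hall : ∀ l (hl : l ∈ S.comp J k), ∀ hl' : l ∈ K, v ⟨l, hl'⟩ = 0 := by
      intro l hl
      induction hl with
      | refl => exact fun _ => hk0
      | @tail b c h1 h2 ih =>
        intro hc
        have hb : b ∈ K := by
          rw [hK, ← comp_eq hi k.2]
          exact h1
        exact hstep ⟨b, hb⟩ ⟨c, hc⟩ h2.2 (ih hb)
    funext l
    refine hall l ?_ l.2
    rw [comp_eq hi k.2]
    exact l.2

/-- Positive vectors restrict to principal submatrices, so a component lying inside one of finite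
type is itself of finite type. -/
theorem infPart_mono (hA : IsCoxeterCartan S.cartanMatrix) (h : J ⊆ K) :
    S.infPart J ⊆ S.infPart K := by
  classical
  intro i hi
  rw [mem_infPart_iff] at hi ⊢
  refine ⟨h hi.1, fun hfin => hi.2 (IsFiniteType.of_isPositiveOn hA hi.1 ?_)⟩
  exact hA.isPositiveOn_mono (Set.toFinset_subset_toFinset.2 (comp_mono h)) hfin.isPositiveOn

theorem comp_subset_infPart (hi : i ∈ S.infPart J) : S.comp J i ⊆ S.infPart J := by
  intro k hk
  rw [mem_infPart_iff] at hi ⊢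
  rw [comp_eq hi.1 hk]
  exact ⟨comp_subset hi.1 hk, hi.2⟩

theorem infPart_infPart : S.infPart (S.infPart J) = S.infPart J := by
  refine infPart_subset.antisymm fun i hi => mem_infPart_iff.2 ⟨hi, ?_⟩
  have : S.comp (S.infPart J) i = S.comp J i := by
    refine (comp_mono infPart_subset).antisymm fun k hk => ?_
    induction hk with
    | refl => exact mem_comp_self
    | tail h1 h2 ih =>
      exact mem_comp_of_adj ih (comp_subset_infPart hi (Relation.ReflTransGen.tail h1 h2)) h2.2
  rw [this]
  exact (mem_infPart_iff.1 hi).2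

theorem comp_subset_sdiff_infPart (hi : i ∈ J \ S.infPart J) :
    S.comp J i ⊆ J \ S.infPart J := by
  intro k hk
  refine ⟨comp_subset hi.1 hk, fun hkinf => hi.2 ?_⟩
  exact comp_subset_infPart hkinf (mem_comp_symm hi.1 hk)

theorem cartanMatrix_eq_zero_of_mem_infPart (hi : i ∈ S.infPart J) (hj : j ∈ J \ S.infPart J) :
    S.cartanMatrix i j = 0 :=
  (cartanMatrix_eq_zero_of_notMem_comp (mem_comp_self (i := i)) hj.1
    fun h => hj.2 (comp_subset_infPart hi h)).1

-- Positive vectors of the finite type components are glued; entries between different components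
-- vanish, so the row sums do not interact.
open Classical in
theorem isPositiveOn_sdiff_infPart (J : Set I) :
    IsPositiveOn S.cartanMatrix (J \ S.infPart J).toFinset := by
  have h : ∀ K : Set I, ∃ u : I → ℝ, S.IsFiniteType K →
      (∀ k ∈ K.toFinset, 0 < u k) ∧ ∀ k ∈ K.toFinset, 0 < ∑ j ∈ K.toFinset,
        S.cartanMatrix k j * u j := by
    intro K
    by_cases hK : S.IsFiniteType K
    · obtain ⟨u, hu⟩ := hK.isPositiveOn
      exact ⟨u, fun _ => hu⟩
    · exact ⟨0, fun h => absurd h hK⟩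
  choose f hf using h
  have hfin : ∀ k ∈ J \ S.infPart J, S.IsFiniteType (S.comp J k) := fun k hk => by
    by_contra hc
    exact hk.2 (mem_infPart_iff.2 ⟨hk.1, hc⟩)
  refine ⟨fun j => f (S.comp J j) j, fun k hk => ?_, fun k hk => ?_⟩ <;>
    rw [Set.mem_toFinset] at hk
  · exact (hf _ (hfin k hk)).1 k (by simpa using mem_comp_self)
  · have h1 := (hf _ (hfin k hk)).2 k (by simpa using mem_comp_self)
    refine h1.trans_eq ?_
    have hsub : (S.comp J k).toFinset ⊆ (J \ S.infPart J).toFinset :=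
      Set.toFinset_subset_toFinset.2 (comp_subset_sdiff_infPart hk)
    rw [← Finset.sum_subset hsub]
    · refine Finset.sum_congr rfl fun j hj => ?_
      rw [Set.mem_toFinset] at hj
      simp only [comp_eq hk.1 hj]
    · intro j hj hj'
      rw [Set.mem_toFinset] at hj hj'
      rw [(cartanMatrix_eq_zero_of_notMem_comp mem_comp_self hj.1 hj').1, zero_mul]

/-- A large multiple of `μ` is perturbed by the combination `π` of the `α j` over the finite part of
its zero set. As `π` is positive on that part and vanishes on the nonfinite part, the zero set
shrinks to exactly the nonfinite part. -/
theorem isSpecialFacial_infPart {μ : Module.Dual ℝ 𝔥} (hμ : μ ∈ S.closedChamber) :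
    S.IsSpecialFacial (S.infPart {i | μ (S.h i) = 0}) := by
  classical
  refine ⟨infPart_infPart, ?_⟩
  set J := {i | μ (S.h i) = 0} with hJ
  obtain ⟨u, hu, hAu⟩ := isPositiveOn_sdiff_infPart (S := S) J
  set F := (J \ S.infPart J).toFinset with hF
  let π : Module.Dual ℝ 𝔥 := ∑ j ∈ F, u j • S.α j
  have hπ : ∀ k, π (S.h k) = ∑ j ∈ F, S.cartanMatrix k j * u j := fun k => by
    simp only [π, LinearMap.sum_apply, LinearMap.smul_apply, smul_eq_mul, cartanMatrix_apply]
    exact Finset.sum_congr rfl fun j _ => mul_comm _ _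
  obtain ⟨N, hN, hN'⟩ := exists_forall_pos_mul_add Jᶜ (fun i => μ (S.h i)) (fun i => π (S.h i))
    fun i hi => lt_of_le_of_ne (hμ i) (Ne.symm hi)
  have hν : ∀ i, (N • μ + π) (S.h i) = N * μ (S.h i) + π (S.h i) := fun i => by simp
  have hinf : ∀ i ∈ S.infPart J, (N • μ + π) (S.h i) = 0 := by
    intro i hi
    have h1 : i ∈ J := infPart_subset hi
    have h1 : μ (S.h i) = 0 := h1
    rw [hν, h1, hπ, mul_zero, zero_add]
    refine Finset.sum_eq_zero fun j hj => ?_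
    rw [hF, Set.mem_toFinset] at hj
    rw [cartanMatrix_eq_zero_of_mem_infPart hi hj, zero_mul]
  have hpos : ∀ i, i ∉ S.infPart J → 0 < (N • μ + π) (S.h i) := by
    intro i hi
    rw [hν]
    by_cases hiJ : i ∈ J
    · have h1 : μ (S.h i) = 0 := hiJ
      rw [h1, mul_zero, zero_add, hπ]
      exact hAu i (by simp [hF, hiJ, hi])
    · exact hN' N le_rfl i hiJ
  have hmem : N • μ + π ∈ S.closedChamber := fun i => by
    by_cases hi : i ∈ S.infPart J
    · exact (hinf i hi).ge
    · exact (hpos i hi).le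
  convert isFacial_zeroSet hmem using 1
  ext i
  constructor
  · exact hinf i
  · intro h
    by_contra hi
    exact (hpos i hi).ne' h

end RayFamily

/-! ### Gradedness -/

theorem mem_of_maximal_chain {α : Type*} [PartialOrder α] {s c : Set α}
    (hc : Maximal (fun t : Set α => t ⊆ s ∧ IsChain (· ≤ ·) t) c) {z : α} (hz : z ∈ s)
    (hcomp : ∀ x ∈ c, x ≤ z ∨ z ≤ x) : z ∈ c := by
  have h1 : insert z c ⊆ s ∧ IsChain (· ≤ ·) (insert z c) :=
    ⟨Set.insert_subset hz hc.prop.1, hc.prop.2.insert fun x hx _ => (hcomp x hx).symm⟩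
  exact hc.le_of_ge h1 (Set.subset_insert z c) (Set.mem_insert z c)

/-- A gap in a maximal chain would be filled by the element supplied by `hcov`, so `d` maps the
chain bijectively onto the integer interval from `d a` to `d b`. -/
theorem maximal_chain_graded {α : Type*} [PartialOrder α] {s c : Set α} {a b : α} (ha : a ∈ s)
    (hb : b ∈ s) (hs : ∀ x ∈ s, a ≤ x ∧ x ≤ b) (d : α → ℕ)
    (hd : ∀ x ∈ s, ∀ y ∈ s, x < y → d x < d y)
    (hcov : ∀ x ∈ s, ∀ y ∈ s, x < y → ∃ z ∈ s, x ≤ z ∧ z ≤ y ∧ d z = d x + 1)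
    (hc : Maximal (fun t : Set α => t ⊆ s ∧ IsChain (· ≤ ·) t) c) :
    (∀ p ∈ c, ∀ q ∈ c, p < q → (∀ r ∈ c, ¬ (p < r ∧ r < q)) → d q = d p + 1) ∧
      c.Finite ∧ (c.ncard : ℤ) = (d b : ℤ) - (d a : ℤ) + 1 := by
  have hmem : ∀ z ∈ s, (∀ x ∈ c, x ≤ z ∨ z ≤ x) → z ∈ c := fun z hz hcomp =>
    mem_of_maximal_chain hc hz hcomp
  have hcs := hc.prop.1
  have hch := hc.prop.2
  have hac : a ∈ c := hmem a ha fun x hx => Or.inr (hs x (hcs hx)).1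
  have hbc : b ∈ c := hmem b hb fun x hx => Or.inl (hs x (hcs hx)).2
  have hstep : ∀ p ∈ c, ∀ q ∈ c, p < q → (∀ r ∈ c, ¬ (p < r ∧ r < q)) → d q = d p + 1 := by
    intro p hp q hq hpq hno
    obtain ⟨z, hz, hpz, hzq, hdz⟩ := hcov p (hcs hp) q (hcs hq) hpq
    have hzc : z ∈ c := hmem z hz fun x hx => by
      rcases hch.total hx hp with h | h
      · exact Or.inl (h.trans hpz)
      · rcases h.eq_or_lt with rfl | h
        · exact Or.inl hpz
        rcases hch.total hx hq with h' | h'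
        · rcases h'.eq_or_lt with rfl | h'
          · exact Or.inr hzq
          · exact absurd ⟨h, h'⟩ (hno x hx)
        · exact Or.inr (hzq.trans h')
    have hpz' : p < z := lt_of_le_of_ne hpz (by rintro rfl; omega)
    rcases hzq.eq_or_lt with rfl | hlt
    · exact hdz
    · exact absurd ⟨hpz', hlt⟩ (hno z hzc)
  have hinj : Set.InjOn d c := by
    intro p hp q hq h
    rcases hch.total hp hq with h' | h'
    · rcases h'.eq_or_lt with rfl | h'
      · rfl
      · have := hd p (hcs hp) q (hcs hq) h'; omega
    · rcases h'.eq_or_lt with rfl | h'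
      · rfl
      · have := hd q (hcs hq) p (hcs hp) h'; omega
  have hmono : ∀ p ∈ s, ∀ q ∈ s, p ≤ q → d p ≤ d q := fun p hp q hq h => by
    rcases h.eq_or_lt with rfl | h
    · rfl
    · exact (hd p hp q hq h).le
  have himg : d '' c = Set.Icc (d a) (d b) := by
    apply Set.Subset.antisymm
    · rintro _ ⟨x, hx, rfl⟩
      exact ⟨hmono a ha x (hcs hx) (hs x (hcs hx)).1, hmono x (hcs hx) b hb (hs x (hcs hx)).2⟩
    · rintro n ⟨h1, h2⟩
      induction n, h1 using Nat.le_induction with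
      | base => exact ⟨a, hac, rfl⟩
      | succ n h1 ih =>
        obtain ⟨p, hp, hpn⟩ := ih (by omega)
        have hpb : p < b := lt_of_le_of_ne (hs p (hcs hp)).2 (by rintro rfl; omega)
        obtain ⟨q, ⟨hq, hpq⟩, hmin⟩ := exists_minimalFor_of_wellFoundedLT
          (fun x => x ∈ c ∧ p < x) d ⟨b, hbc, hpb⟩
        refine ⟨q, hq, ?_⟩
        rw [hstep p hp q hq hpq, hpn]
        rintro r hr ⟨hpr, hrq⟩
        have h3 := hd r (hcs hr) q (hcs hq) hrq
        have h4 := hmin ⟨hr, hpr⟩ h3.le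
        omega
  have hfin : c.Finite := Set.Finite.of_finite_image (by rw [himg]; exact Set.finite_Icc _ _) hinj
  refine ⟨hstep, hfin, ?_⟩
  rw [← hinj.ncard_image, himg, ← Finset.coe_Icc, Set.ncard_coe_finset, Nat.card_Icc]
  have := hmono a ha b hb (hs b hb).1
  omega

/-! ### Covering faces -/

section Cover

variable {V : Type*} [AddCommGroup V] [Module ℝ V]

theorem PointedCone.IsFaceOf.mem_of_mem_span [FiniteDimensional ℝ V] {P Q : PointedCone ℝ V}
    (h : P.IsFaceOf Q) {x : V} (hx : x ∈ Q) (hxP : x ∈ Submodule.span ℝ (P : Set V)) : x ∈ P := by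
  obtain ⟨y, hy⟩ := exists_isInner P
  obtain ⟨N, hN, h'⟩ := hy.exists_smul_sub_mem (Submodule.neg_mem _ hxP)
  refine h.mem_of_add_mem_left hx (h.le h') ?_
  convert PointedCone.smul_mem P hN hy.1 using 1
  module

theorem PointedCone.mem_hull_finset {E : Finset V} {x : V} :
    x ∈ PointedCone.hull ℝ (E : Set V) ↔
      ∃ a : V → ℝ, (∀ v, 0 ≤ a v) ∧ ∑ v ∈ E, a v • v = x := by
  constructor
  · intro hx
    obtain ⟨c, hc, hc0, rfl⟩ := PointedCone.mem_hull_set.1 hx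
    refine ⟨c, hc0, ?_⟩
    rw [Finsupp.sum]
    refine (Finset.sum_subset (by exact_mod_cast hc) fun v _ hv => ?_).symm
    rw [Finsupp.notMem_support_iff.1 hv, zero_smul]
  · rintro ⟨a, ha, rfl⟩
    exact Submodule.sum_mem _ fun v hv =>
      PointedCone.smul_mem _ (ha v) (PointedCone.subset_hull hv)

/-- The points of `Q` which lie on the ray of `e` modulo the linear hull of `P`. -/
def rayFace (P Q : PointedCone ℝ V) (e : V) : PointedCone ℝ V where
  carrier := {x | x ∈ Q ∧ ∃ t : ℝ, 0 ≤ t ∧ x - t • e ∈ Submodule.span ℝ (P : Set V)}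
  zero_mem' := ⟨Q.zero_mem, 0, le_rfl, by simp⟩
  add_mem' := by
    rintro x y ⟨hx, s, hs, hs'⟩ ⟨hy, t, ht, ht'⟩
    refine ⟨Q.add_mem hx hy, s + t, add_nonneg hs ht, ?_⟩
    convert Submodule.add_mem _ hs' ht' using 1
    module
  smul_mem' := by
    rintro a x ⟨hx, s, hs, hs'⟩
    refine ⟨Submodule.smul_mem Q a hx, a * s, mul_nonneg a.2 hs, ?_⟩
    convert Submodule.smul_mem _ (a : ℝ) hs' using 1
    rw [smul_sub, smul_smul]
    rfl

variable [FiniteDimensional ℝ V]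

theorem coneDim_rayFace {P Q : PointedCone ℝ V} (hPQ : P ≤ Q) {e : V} (he : e ∈ Q)
    (heP : e ∉ Submodule.span ℝ (P : Set V)) : coneDim (rayFace P Q e) = coneDim P + 1 := by
  have hspan : Submodule.span ℝ (rayFace P Q e : Set V) =
      Submodule.span ℝ (P : Set V) ⊔ Submodule.span ℝ {e} := by
    apply le_antisymm
    · rw [Submodule.span_le]
      rintro x ⟨-, t, -, ht⟩
      have : x = (x - t • e) + t • e := by module
      rw [this]
      exact Submodule.add_mem_sup ht (Submodule.smul_mem _ _ (Submodule.mem_span_singleton_self e))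
    · refine sup_le (Submodule.span_mono fun x hx => ⟨hPQ hx, 0, le_rfl, ?_⟩) ?_
      · simpa using Submodule.subset_span hx
      · rw [Submodule.span_singleton_le_iff_mem]
        exact Submodule.subset_span ⟨he, 1, zero_le_one, by simp⟩
  have hdisj : Submodule.span ℝ (P : Set V) ⊓ Submodule.span ℝ {e} = ⊥ := by
    rw [eq_bot_iff]
    rintro x ⟨hx, hx'⟩
    obtain ⟨t, rfl⟩ := Submodule.mem_span_singleton.1 hx'
    by_cases ht : t = 0
    · simp [ht]
    · exact absurd ((Submodule.smul_mem_iff _ ht).1 hx) heP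
  have h1 := Submodule.finrank_sup_add_finrank_inf_eq (Submodule.span ℝ (P : Set V))
    (Submodule.span ℝ {e})
  have he0 : e ≠ 0 := fun h => heP (h ▸ Submodule.zero_mem _)
  rw [hdisj, finrank_bot, add_zero, finrank_span_singleton he0] at h1
  unfold coneDim
  rw [hspan, h1]

/-- Only the image of `Q` modulo the linear hull of `P` has to be finitely generated. Since `P` is a
face, that image is a pointed cone, and a nonzero generator that cannot be omitted spans an extreme
ray; the face sought is its preimage in `Q`. -/
theorem exists_face_coneDim_eq_succ {P Q : PointedCone ℝ V} (hPQ : P.IsFaceOf Q) (hne : P ≠ Q)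
    (E : Finset V) (hEQ : ∀ e ∈ E, e ∈ Q)
    (hE : ∀ x ∈ Q, ∃ l ∈ Submodule.span ℝ (P : Set V), x + l ∈ PointedCone.hull ℝ (E : Set V)) :
    ∃ R : PointedCone ℝ V, R.IsFaceOf Q ∧ P ≤ R ∧ coneDim R = coneDim P + 1 := by
  classical
  induction hn : E.card using Nat.strong_induction_on generalizing E with
  | _ n ih =>
  set L := Submodule.span ℝ (P : Set V) with hL
  obtain ⟨e, he, heL⟩ : ∃ e ∈ E, e ∉ L := by
    by_contra! hall
    refine hne (le_antisymm hPQ.le fun x hx => hPQ.mem_of_mem_span hx ?_)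
    obtain ⟨l, hl, hxl⟩ := hE x hx
    obtain ⟨a, -, ha⟩ := PointedCone.mem_hull_finset.1 hxl
    have h1 : x + l ∈ L := ha ▸ Submodule.sum_mem _ fun v hv => Submodule.smul_mem _ _ (hall v hv)
    exact (Submodule.add_mem_iff_left _ hl).1 h1
  by_cases hred : ∃ l ∈ L, e + l ∈ PointedCone.hull ℝ (E.erase e : Set V)
  · obtain ⟨l₀, hl₀, hel⟩ := hred
    refine ih (E.erase e).card (by rw [← hn]; exact Finset.card_erase_lt_of_mem he) (E.erase e)
      (fun v hv => hEQ v (Finset.mem_of_mem_erase hv)) (fun x hx => ?_) rfl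
    obtain ⟨l, hl, hxl⟩ := hE x hx
    obtain ⟨a, ha0, ha⟩ := PointedCone.mem_hull_finset.1 hxl
    refine ⟨l + a e • l₀, add_mem hl (Submodule.smul_mem _ _ hl₀), ?_⟩
    have h1 : x + (l + a e • l₀) = a e • (e + l₀) + ∑ v ∈ E.erase e, a v • v := by
      rw [← add_assoc, ← ha, ← Finset.add_sum_erase E _ he]
      module
    rw [h1]
    rw [Finset.coe_erase] at *
    refine add_mem (PointedCone.smul_mem _ (ha0 e) hel) (sum_mem fun v hv => ?_)
    refine PointedCone.smul_mem _ (ha0 v) (PointedCone.subset_hull ?_)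
    simpa [and_comm] using hv
  · refine ⟨rayFace P Q e, ?_, fun x hx => ⟨hPQ.le hx, 0, le_rfl, ?_⟩,
      coneDim_rayFace hPQ.le (hEQ e he) heL⟩
    swap
    · simpa using Submodule.subset_span hx
    refine PointedCone.IsFaceOf.of_mem_of_add_mem_left (fun x hx => hx.1) ?_
    rintro x y hx hy ⟨-, t, ht, hxy⟩
    obtain ⟨l, hl, hxl⟩ := hE x hx
    obtain ⟨m, hm, hym⟩ := hE y hy
    obtain ⟨a, ha0, ha⟩ := PointedCone.mem_hull_finset.1 hxl
    obtain ⟨b, hb0, hb⟩ := PointedCone.mem_hull_finset.1 hym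
    rw [← Finset.add_sum_erase E _ he] at ha hb
    have hzQ : ∀ c : V → ℝ, (∀ v, 0 ≤ c v) → ∑ v ∈ E.erase e, c v • v ∈ Q := fun c hc =>
      sum_mem fun v hv => PointedCone.smul_mem Q (hc v) (hEQ v (Finset.mem_of_mem_erase hv))
    have hsum : (∑ v ∈ E.erase e, a v • v) + ((∑ v ∈ E.erase e, b v • v) + (a e + b e - t) • e)
        ∈ L := by
      have h1 := add_mem hxy (add_mem hl hm)
      convert h1 using 1
      have h2 : x + y + (l + m) = (x + l) + (y + m) := by abel
      have h3 : x + y - t • e + (l + m) = (x + l) + (y + m) - t • e := by abel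
      rw [h3, ← ha, ← hb]
      module
    -- If the coefficients of `e` add up to less than `t`, then `e` is, modulo `L`, a nonnegative
    -- combination of the other generators, contrary to irredundance. Otherwise a sum of elements of
    -- `Q` lies in `L`, hence in the face `P`, and so does the part of `x` away from `e`.
    rcases lt_or_ge (a e + b e) t with hlt | hge
    · refine absurd ?_ hred
      set r := (t - (a e + b e))⁻¹ with hr
      have hr0 : 0 < r := inv_pos.2 (by linarith)
      refine ⟨r • ((∑ v ∈ E.erase e, a v • v) + ((∑ v ∈ E.erase e, b v • v) +
        (a e + b e - t) • e)), Submodule.smul_mem _ _ hsum, ?_⟩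
      have h1 : e + r • ((∑ v ∈ E.erase e, a v • v) + ((∑ v ∈ E.erase e, b v • v) +
          (a e + b e - t) • e)) = ∑ v ∈ E.erase e, (r * (a v + b v)) • v := by
        have h2 : r * (a e + b e - t) = -1 := by
          rw [hr]
          have : t - (a e + b e) ≠ 0 := by linarith
          field_simp
          ring
        have h3 : ∑ v ∈ E.erase e, (r * (a v + b v)) • v =
            r • ((∑ v ∈ E.erase e, a v • v) + ∑ v ∈ E.erase e, b v • v) := by
          rw [← Finset.sum_add_distrib, Finset.smul_sum]
          exact Finset.sum_congr rfl fun v _ => by module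
        rw [h3]
        generalize ∑ v ∈ E.erase e, a v • v = A
        generalize ∑ v ∈ E.erase e, b v • v = B
        have h4 : e + r • (A + (B + (a e + b e - t) • e)) =
            r • (A + B) + (1 + r * (a e + b e - t)) • e := by module
        rw [h4, h2]
        simp
      rw [h1]
      exact PointedCone.mem_hull_finset.2 ⟨fun v => r * (a v + b v),
        fun v => mul_nonneg hr0.le (add_nonneg (ha0 v) (hb0 v)), rfl⟩
    · have h1 : (∑ v ∈ E.erase e, b v • v) + (a e + b e - t) • e ∈ Q :=
        add_mem (hzQ b hb0) (PointedCone.smul_mem Q (by linarith) (hEQ e he))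
      have h2 := hPQ.mem_of_mem_span (add_mem (hzQ a ha0) h1) hsum
      have h3 := hPQ.mem_of_add_mem_left (hzQ a ha0) h1 h2
      refine ⟨hx, a e, ha0 e, ?_⟩
      have h4 : x - a e • e = (∑ v ∈ E.erase e, a v • v) - l := by
        rw [eq_sub_iff_add_eq]
        have : x - a e • e + l = (x + l) - a e • e := by abel
        rw [this, ← ha]
        abel
      rw [h4]
      exact sub_mem (Submodule.subset_span h3) hl

end Cover

/-! ### The cross section lattice -/

namespace RayFamily

variable {I 𝔥 : Type*} [AddCommGroup 𝔥] [Module ℝ 𝔥] {S : RayFamily I 𝔥}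
  {Y P Q R R₁ R₂ : PointedCone ℝ (Module.Dual ℝ 𝔥)} {Θ : Set I}

theorem mem_upsilonLower_iff {i : I} : i ∈ S.upsilonLower R ↔ ∀ μ ∈ R, μ (S.h i) = 0 :=
  forall₂_congr fun μ _ => S.σ_apply_eq_self_iff i μ

theorem upsilonLower_anti (h : P ≤ Q) : S.upsilonLower Q ⊆ S.upsilonLower P :=
  fun _ hi μ hμ => hi μ (h hμ)

theorem upsilonLower_subset_upsilon : S.upsilonLower R ⊆ S.upsilon R := by
  intro i hi
  have h : S.σ i '' (R : Set (Module.Dual ℝ 𝔥)) = R := by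
    rw [Set.image_congr hi]
    exact Set.image_id' _
  exact SetLike.coe_injective h

theorem map_eq_of_mem_parabolic_upsilonLower {w : Module.Dual ℝ 𝔥 ≃ₗ[ℝ] Module.Dual ℝ 𝔥}
    (hw : w ∈ S.parabolic (S.upsilonLower R)) :
    R.map (w : Module.Dual ℝ 𝔥 →ₗ[ℝ] Module.Dual ℝ 𝔥) = R := by
  have h : w '' (R : Set (Module.Dual ℝ 𝔥)) = R := by
    rw [Set.image_congr fun μ hμ => S.parabolic_apply_eq_self hw
      fun i hi => mem_upsilonLower_iff.1 hi μ hμ]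
    exact Set.image_id' _
  exact SetLike.coe_injective h

theorem mem_crossSection_iff [FiniteDimensional ℝ 𝔥] : R ∈ S.crossSection Y ↔
    R.IsFaceOf Y ∧ ∃ μ, IsInner R μ ∧ μ ∈ S.closedChamber := by
  refine and_congr Iff.rfl (exists_congr fun μ => ?_)
  rw [Set.mem_inter_iff, mem_relInterior_iff]
  rfl

theorem exists_smul_add_mem_closedChamber [Fintype I] {ν y : Module.Dual ℝ 𝔥}
    (hν : ν ∈ S.closedChamber) (hy : ∀ j, ν (S.h j) = 0 → 0 ≤ y (S.h j)) :
    ∃ N : ℝ, 0 < N ∧ N • ν + y ∈ S.closedChamber ∧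
      ∀ j, ν (S.h j) ≠ 0 → 0 < (N • ν + y) (S.h j) := by
  obtain ⟨N, hN, hN'⟩ := exists_forall_pos_mul_add {j | ν (S.h j) ≠ 0} (fun j => ν (S.h j))
    (fun j => y (S.h j)) fun j hj => lt_of_le_of_ne (hν j) (Ne.symm hj)
  have hpos : ∀ j, ν (S.h j) ≠ 0 → 0 < (N • ν + y) (S.h j) := fun j hj => hN' N le_rfl j hj
  refine ⟨N, hN, fun j => ?_, hpos⟩
  by_cases hj : ν (S.h j) = 0
  · simpa [hj] using hy j hj
  · exact (hpos j hj).le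

/-- A reflection which stabilizes a face `R₁` without fixing it pointwise stabilizes every larger
face. -/
theorem upsilonUpper_subset_upsilon [FiniteDimensional ℝ 𝔥]
    (hYW : ∀ w ∈ S.weylGroup, ∀ μ ∈ Y, w μ ∈ Y) (hR : R.IsFaceOf Y) (h : R₁ ≤ R) :
    S.upsilonUpper R₁ ⊆ S.upsilon R := by
  rintro i ⟨hi, hi'⟩
  rw [mem_upsilonLower_iff] at hi'
  push Not at hi'
  obtain ⟨ν, hν, hνi⟩ := hi'
  have hσ : ∀ x ∈ R₁, S.σ i x ∈ R₁ := fun x hx => by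
    have h1 : R₁.map (S.σ i : Module.Dual ℝ 𝔥 →ₗ[ℝ] Module.Dual ℝ 𝔥) = R₁ := hi
    rw [← h1]
    exact ⟨x, hx, rfl⟩
  obtain ⟨ξ, hξ⟩ := exists_isInner R₁
  have hξ' := hξ.add (hσ ξ hξ.1)
  set η := ξ + S.σ i ξ with hη
  have hση : S.σ i η = η := by
    rw [hη, map_add, σ_apply_self, add_comm]
  have hα : S.α i ∈ Submodule.span ℝ (R₁ : Set (Module.Dual ℝ 𝔥)) := by
    have h1 : S.α i = (ν (S.h i))⁻¹ • (ν - S.σ i ν) := by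
      rw [σ_apply, sub_sub_cancel, smul_smul, inv_mul_cancel₀ hνi, one_smul]
    rw [h1]
    exact Submodule.smul_mem _ _ (sub_mem (Submodule.subset_span hν)
      (Submodule.subset_span (hσ ν hν)))
  obtain ⟨μ, hμ⟩ := exists_isInner R
  -- The vector `η` is inner in `R₁` and fixed by `σ i`, and `α i` lies in the span of `R₁`. A large
  -- multiple of `η` therefore absorbs the displacement of `μ`, and both `μ + N • η` and its
  -- reflection are inner in `R`.
  obtain ⟨N, hN, hN'⟩ := hξ'.exists_smul_sub_mem
    (Submodule.smul_mem _ (-(μ (S.h i))) hα)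
  have h1 : IsInner R (μ + N • η) := hμ.add (h (PointedCone.smul_mem _ hN hξ'.1))
  have h2 : IsInner R (S.σ i (μ + N • η)) := by
    have h3 : S.σ i (μ + N • η) = μ + (N • η + (-(μ (S.h i))) • S.α i) := by
      rw [map_add, map_smul, hση, σ_apply]
      module
    rw [h3]
    exact hμ.add (h hN')
  exact IsInner.eq_of_inner (S.isFaceOf_map hYW hR (S.σ_mem_weylGroup i)) hR
    (h1.map (S.σ i).toLinearMap) h2

/-- A reflection fixing a face pointwise and stabilizing a face of dimension one more fixes the
latter pointwise. -/
theorem mem_upsilonLower_of_coneDim_eq_succ [FiniteDimensional ℝ 𝔥] (hPQ : P.IsFaceOf Q)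
    (hdim : coneDim Q = coneDim P + 1) {i : I} (hP : i ∈ S.upsilonLower P)
    (hQ : i ∈ S.upsilon Q) : i ∈ S.upsilonLower Q := by
  rw [mem_upsilonLower_iff] at hP ⊢
  by_contra! hc
  obtain ⟨x, hx, hxi⟩ := hc
  have hσx : S.σ i x ∈ Q := by
    have h1 : Q.map (S.σ i : Module.Dual ℝ 𝔥 →ₗ[ℝ] Module.Dual ℝ 𝔥) = Q := hQ
    rw [← h1]
    exact ⟨x, hx, rfl⟩
  let k := LinearMap.ker (Module.Dual.eval ℝ 𝔥 (S.h i))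
  have hlt : Submodule.span ℝ (Q : Set (Module.Dual ℝ 𝔥)) ⊓ k <
      Submodule.span ℝ (Q : Set (Module.Dual ℝ 𝔥)) := by
    refine lt_of_le_of_ne inf_le_left fun h => hxi ?_
    have h1 : x ∈ Submodule.span ℝ (Q : Set (Module.Dual ℝ 𝔥)) ⊓ k := by
      rw [h]
      exact Submodule.subset_span hx
    exact h1.2
  -- By dimension, `P` spans the whole fixed hyperplane inside the span of `Q`. The fixed point `x +
  -- σ x` then lies in `P`, and the face property puts `x` there too.
  have heq : Submodule.span ℝ (P : Set (Module.Dual ℝ 𝔥)) =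
      Submodule.span ℝ (Q : Set (Module.Dual ℝ 𝔥)) ⊓ k := by
    refine Submodule.eq_of_le_of_finrank_le
      (le_inf (Submodule.span_mono hPQ.le) (Submodule.span_le.2 hP)) ?_
    have := Submodule.finrank_lt_finrank_of_lt hlt
    unfold coneDim at hdim
    omega
  have h1 : x + S.σ i x ∈ Submodule.span ℝ (P : Set (Module.Dual ℝ 𝔥)) := by
    rw [heq]
    refine ⟨Submodule.subset_span (Q.add_mem hx hσx), ?_⟩
    change (x + S.σ i x) (S.h i) = 0
    rw [LinearMap.add_apply, σ_apply_h, add_neg_cancel]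
  have h2 := hPQ.mem_of_mem_span (Q.add_mem hx hσx) h1
  exact hxi (hP x (hPQ.mem_of_add_mem_left hx hσx h2))

theorem exists_weylGroup_map_mem_crossSection [FiniteDimensional ℝ 𝔥]
    (hYX : (Y : Set (Module.Dual ℝ 𝔥)) ⊆ S.titsCone)
    (hYW : ∀ w ∈ S.weylGroup, ∀ μ ∈ Y, w μ ∈ Y) (hR : R.IsFaceOf Y) :
    ∃ w ∈ S.weylGroup, R.map (w : Module.Dual ℝ 𝔥 →ₗ[ℝ] Module.Dual ℝ 𝔥) ∈ S.crossSection Y := by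
  obtain ⟨x, hx⟩ := exists_isInner R
  have hxX := hYX (hR.le hx.1)
  simp only [titsCone, Set.mem_iUnion] at hxX
  obtain ⟨w, hw, ν, hν, hwν⟩ := hxX
  refine ⟨w⁻¹, inv_mem hw,
    mem_crossSection_iff.2 ⟨S.isFaceOf_map hYW hR (inv_mem hw), ν, ?_, hν⟩⟩
  have h1 := hx.map (w⁻¹).toLinearMap
  have h2 : (w⁻¹).toLinearMap x = ν := by
    rw [← hwν]
    exact w.symm_apply_apply ν
  rwa [h2] at h1

variable [Fintype I]

theorem mem_facePart_iff : R ∈ S.facePart Y Θ ↔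
    ∃ w ∈ S.weylGroup,
      R.map (w : Module.Dual ℝ 𝔥 →ₗ[ℝ] Module.Dual ℝ 𝔥) ∈ S.crossSectionPart Y Θ := by
  constructor
  · rintro ⟨w, hw, R', hR', rfl⟩
    exact ⟨w⁻¹, inv_mem hw, by rwa [PointedCone.map_inv_map]⟩
  · rintro ⟨w, hw, h⟩
    refine ⟨w⁻¹, inv_mem hw, _, h, (R.map_inv_map w).symm⟩

theorem facePart_subset (hYW : ∀ w ∈ S.weylGroup, ∀ μ ∈ Y, w μ ∈ Y) :
    S.facePart Y Θ ⊆ faceSet Y := by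
  rintro _ ⟨w, hw, R', hR', rfl⟩
  exact S.isFaceOf_map hYW hR'.1.1 hw

theorem map_mem_facePart (hR : R ∈ S.facePart Y Θ)
    {w : Module.Dual ℝ 𝔥 ≃ₗ[ℝ] Module.Dual ℝ 𝔥} (hw : w ∈ S.weylGroup) :
    R.map (w : Module.Dual ℝ 𝔥 →ₗ[ℝ] Module.Dual ℝ 𝔥) ∈ S.facePart Y Θ := by
  obtain ⟨w', hw', R', hR', rfl⟩ := hR
  exact ⟨w * w', mul_mem hw hw', R', hR', (R'.map_equiv_mul w w').symm⟩

variable [FiniteDimensional ℝ 𝔥]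

/-- A point with minimal zero set is generic. If `x ∈ R` is nonzero on some `h i` with `i` in the
zero set `J` of `μ`, it is made `J`-dominant by a group element fixing `μ`, hence stabilizing `R`,
and is then added to a large multiple of `μ`. -/
theorem exists_isInner_zeroSet (hS : S.IsLinearCoxeterSystem)
    (hYX : (Y : Set (Module.Dual ℝ 𝔥)) ⊆ S.titsCone)
    (hYW : ∀ w ∈ S.weylGroup, ∀ μ ∈ Y, w μ ∈ Y) (hR : R ∈ S.crossSection Y) :
    ∃ μ, IsInner R μ ∧ μ ∈ S.closedChamber ∧ {i | μ (S.h i) = 0} = S.upsilonLower R := by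
  obtain ⟨hRY, μ, hμ, hμC⟩ := mem_crossSection_iff.1 hR
  induction hn : {i | μ (S.h i) = 0}.ncard using Nat.strong_induction_on generalizing μ with
  | _ n ih =>
  set J := {i | μ (S.h i) = 0} with hJ
  have hsub : S.upsilonLower R ⊆ J := fun i hi => mem_upsilonLower_iff.1 hi μ hμ.1
  by_cases hJR : J ⊆ S.upsilonLower R
  · exact ⟨μ, hμ, hμC, hJR.antisymm hsub⟩
  obtain ⟨i, hi, hiR⟩ := Set.not_subset.1 hJR
  rw [mem_upsilonLower_iff] at hiR
  push Not at hiR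
  obtain ⟨x, hx, hxi⟩ := hiR
  obtain ⟨v, hv, hvx⟩ := hS.exists_parabolic_nonneg J (hYX (hRY.le hx))
  have hvμ : v μ = μ := S.parabolic_apply_eq_self hv fun j hj => hj
  have hvR := S.map_eq_of_apply_eq hYW hRY (S.parabolic_le _ hv) hμ hvμ
  have hvxR : v x ∈ R := by
    rw [← hvR]
    exact ⟨x, hx, rfl⟩
  obtain ⟨N, hN, hNC, hNpos⟩ := exists_smul_add_mem_closedChamber hμC hvx
  refine ih _ ?_ (N • μ + v x) ((hμ.smul hN).add hvxR) hNC rfl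
  rw [← hn]
  refine Set.ncard_lt_ncard ⟨fun j hj => ?_, fun hle => hxi ?_⟩ (Set.toFinite _)
  · by_contra hj'
    exact (hNpos j hj').ne' hj
  -- If nothing were gained, `v x` would be fixed by `v⁻¹`, so `x = v x` would vanish on `h i`.
  · have h1 : ∀ j ∈ J, (v x) (S.h j) = 0 := fun j hj => by
      have h2 : (N • μ + v x) (S.h j) = 0 := hle hj
      have h3 : μ (S.h j) = 0 := hj
      simpa [h3] using h2
    have h2 := S.parabolic_apply_eq_self (inv_mem hv) h1
    have h3 : v⁻¹ (v x) = x := v.symm_apply_apply x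
    rw [h3] at h2
    rw [h2]
    exact h1 i hi

/-- The group fixing `P` pointwise suffices: it makes an inner point of `Q` nonnegative on `υ_*(P)`,
and a generic inner point of `P` repairs the remaining inequalities. -/
theorem exists_map_mem_crossSection (hS : S.IsLinearCoxeterSystem)
    (hYX : (Y : Set (Module.Dual ℝ 𝔥)) ⊆ S.titsCone)
    (hYW : ∀ w ∈ S.weylGroup, ∀ μ ∈ Y, w μ ∈ Y) (hP : P ∈ S.crossSection Y)
    (hQ : Q.IsFaceOf Y) (hPQ : P ≤ Q) :
    ∃ v ∈ S.parabolic (S.upsilonLower P),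
      Q.map (v : Module.Dual ℝ 𝔥 →ₗ[ℝ] Module.Dual ℝ 𝔥) ∈ S.crossSection Y := by
  obtain ⟨μ, hμ, hμC, hJ⟩ := exists_isInner_zeroSet hS hYX hYW hP
  obtain ⟨x, hx⟩ := exists_isInner Q
  obtain ⟨v, hv, hvx⟩ := hS.exists_parabolic_nonneg (S.upsilonLower P) (hYX (hQ.le hx.1))
  refine ⟨v, hv, mem_crossSection_iff.2 ⟨S.isFaceOf_map hYW hQ (S.parabolic_le _ hv), ?_⟩⟩
  rw [← hJ] at hvx
  obtain ⟨N, hN, hNC, -⟩ := exists_smul_add_mem_closedChamber hμC hvx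
  have hvμ : v μ = μ := S.parabolic_apply_eq_self hv fun j hj => by
    rw [← hJ] at hj
    exact hj
  refine ⟨N • μ + v x, ?_, hNC⟩
  rw [add_comm]
  exact (hx.map v.toLinearMap).add (PointedCone.smul_mem _ hN.le ⟨μ, hPQ hμ.1, hvμ⟩)

theorem eq_of_map_eq (hS : S.IsLinearCoxeterSystem)
    (hYW : ∀ w ∈ S.weylGroup, ∀ μ ∈ Y, w μ ∈ Y) (h₁ : R₁ ∈ S.crossSection Y)
    (h₂ : R₂ ∈ S.crossSection Y) {w : Module.Dual ℝ 𝔥 ≃ₗ[ℝ] Module.Dual ℝ 𝔥}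
    (hw : w ∈ S.weylGroup)
    (h : R₁.map (w : Module.Dual ℝ 𝔥 →ₗ[ℝ] Module.Dual ℝ 𝔥) = R₂) : R₁ = R₂ := by
  obtain ⟨h₁Y, μ, hμ, hμC⟩ := mem_crossSection_iff.1 h₁
  obtain ⟨h₂Y, ν, hν, hνC⟩ := mem_crossSection_iff.1 h₂
  refine hμ.eq_of_inner h₁Y h₂Y (hS.isInner_of_isInner_apply hYW h₂Y hνC hν hμC hw ?_)
  rw [← h]
  exact hμ.map w.toLinearMap

theorem map_mem_crossSectionPart (hS : S.IsLinearCoxeterSystem)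
    (hYW : ∀ w ∈ S.weylGroup, ∀ μ ∈ Y, w μ ∈ Y) (hR : R ∈ S.facePart Y Θ)
    {w : Module.Dual ℝ 𝔥 ≃ₗ[ℝ] Module.Dual ℝ 𝔥} (hw : w ∈ S.weylGroup)
    (h : R.map (w : Module.Dual ℝ 𝔥 →ₗ[ℝ] Module.Dual ℝ 𝔥) ∈ S.crossSection Y) :
    R.map (w : Module.Dual ℝ 𝔥 →ₗ[ℝ] Module.Dual ℝ 𝔥) ∈ S.crossSectionPart Y Θ := by
  obtain ⟨w', hw', R', hR', rfl⟩ := hR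
  have h1 := eq_of_map_eq hS hYW hR'.1 h (mul_mem hw hw') (R'.map_equiv_mul w w')
  rwa [← h1]

theorem infPart_upsilonLower_eq (hS : S.IsLinearCoxeterSystem)
    (h₁ : R₁ ∈ S.crossSectionPart Y Θ) (h₂ : R₂ ∈ S.crossSectionPart Y Θ) (h₁R : R₁ ≤ R)
    (hR₂ : R ≤ R₂) : S.infPart (S.upsilonLower R) = Θ := by
  have hA := hS.isCoxeterCartan
  refine Set.Subset.antisymm ?_ ?_
  · rw [← h₁.2]
    exact infPart_mono hA (upsilonLower_anti h₁R)
  · rw [← h₂.2]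
    exact infPart_mono hA (upsilonLower_anti hR₂)

/-- A face between two faces in `Υ(Θ)` can be moved into `Υ(Θ)` without moving these two. -/
theorem exists_map_mem_crossSectionPart (hS : S.IsLinearCoxeterSystem)
    (hYX : (Y : Set (Module.Dual ℝ 𝔥)) ⊆ S.titsCone)
    (hYW : ∀ w ∈ S.weylGroup, ∀ μ ∈ Y, w μ ∈ Y) (h₁ : R₁ ∈ S.crossSectionPart Y Θ)
    (h₂ : R₂ ∈ S.crossSectionPart Y Θ) (hR : R.IsFaceOf Y) (h₁R : R₁ ≤ R) (hR₂ : R ≤ R₂) :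
    ∃ v ∈ S.weylGroup,
      R.map (v : Module.Dual ℝ 𝔥 →ₗ[ℝ] Module.Dual ℝ 𝔥) ∈ S.crossSectionPart Y Θ ∧
      R₁ ≤ R.map (v : Module.Dual ℝ 𝔥 →ₗ[ℝ] Module.Dual ℝ 𝔥) ∧
      R.map (v : Module.Dual ℝ 𝔥 →ₗ[ℝ] Module.Dual ℝ 𝔥) ≤ R₂ := by
  obtain ⟨v, hv, hvR⟩ := exists_map_mem_crossSection hS hYX hYW h₁.1 hR h₁R
  have hvW := S.parabolic_le _ hv
  have hle := (PointedCone.map_equiv_le_map_iff v).2 hR₂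
  obtain ⟨v', hv', hv'R₂⟩ := exists_map_mem_crossSection hS hYX hYW hvR
    (S.isFaceOf_map hYW h₂.1.1 hvW) hle
  have hv'W := S.parabolic_le _ hv'
  rw [← PointedCone.map_equiv_mul] at hv'R₂
  -- Although `v` may move `R₂`, the correction `v'` fixes the image of `R` pointwise, and `v' * v`
  -- sends `R₂` to a representative in the cross section, which must be `R₂` itself.
  have h3 := eq_of_map_eq hS hYW h₂.1 hv'R₂ (mul_mem hv'W hvW) rfl
  have h4 := (PointedCone.map_equiv_le_map_iff v).2 h₁R
  rw [map_eq_of_mem_parabolic_upsilonLower hv] at h4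
  have h5 := (PointedCone.map_equiv_le_map_iff v').2 hle
  rw [map_eq_of_mem_parabolic_upsilonLower hv', ← PointedCone.map_equiv_mul, ← h3] at h5
  exact ⟨v, hvW, ⟨hvR, infPart_upsilonLower_eq hS h₁ h₂ h4 h5⟩, h4, h5⟩

-- Equality of types is what makes `Q` finitely generated modulo the span of `P`: on `Θ` the `h j`
-- vanish on `Q`, and the rest of `υ_*(P)` generates a finite group, so finitely many translates of
-- the generators of `Y ∩ C̄` suffice.
open Classical in
theorem exists_covering_face (hS : S.IsLinearCoxeterSystem)
    (hYX : (Y : Set (Module.Dual ℝ 𝔥)) ⊆ S.titsCone)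
    (hYW : ∀ w ∈ S.weylGroup, ∀ μ ∈ Y, w μ ∈ Y) (hYfg : (Y ⊓ S.closedChamber).FG)
    (hP : P ∈ S.crossSectionPart Y Θ) (hQ : Q ∈ S.crossSectionPart Y Θ) (hPQ : P ≤ Q)
    (hne : P ≠ Q) :
    ∃ R : PointedCone ℝ (Module.Dual ℝ 𝔥), R.IsFaceOf Y ∧ P ≤ R ∧ R ≤ Q ∧
      coneDim R = coneDim P + 1 := by
  obtain ⟨μ, hμ, hμC, hJ⟩ := exists_isInner_zeroSet hS hYX hYW hP.1
  set J := S.upsilonLower P with hJdef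
  have hΘ : S.infPart J = Θ := hP.2
  have hQY : Q.IsFaceOf Y := hQ.1.1
  have hPQ' : P.IsFaceOf Q := (hP.1.1.isFaceOf_iff_le hQY).2 hPQ
  have hΘQ : Θ ⊆ S.upsilonLower Q := by
    rw [← hQ.2]
    exact infPart_subset
  have hfin := hS.finite_parabolic (isPositiveOn_sdiff_infPart (S := S) J)
  rw [Set.coe_toFinset, hΘ] at hfin
  obtain ⟨E₀, hE₀⟩ := hYfg
  have hW : ∀ b ∈ S.parabolic (J \ Θ), b ∈ S.weylGroup := fun b hb => S.parabolic_le _ hb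
  -- Different components of `J` are orthogonal, so making `x` dominant on `J \ Θ` leaves its zeros
  -- on `Θ` untouched.
  have hinv : ∀ b ∈ S.parabolic (J \ Θ), ∀ j ∈ Θ, ∀ y : Module.Dual ℝ 𝔥,
      (b y) (S.h j) = y (S.h j) := by
    intro b hb j hj
    induction hb using Subgroup.closure_induction with
    | mem x hx =>
      obtain ⟨k, hk, rfl⟩ := hx
      intro y
      rw [← hΘ] at hj hk
      have h0 : S.α k (S.h j) = 0 := cartanMatrix_eq_zero_of_mem_infPart hj hk
      rw [σ_apply]
      simp [h0]
    | one => exact fun _ => rfl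
    | mul x y _ _ hx hy =>
      intro z
      rw [LinearEquiv.mul_apply, hx, hy]
    | inv x _ hx =>
      intro z
      rw [← hx (x⁻¹ z)]
      exact congrArg (fun t : Module.Dual ℝ 𝔥 => t (S.h j)) (x.apply_symm_apply z)
  let E : Finset (Module.Dual ℝ 𝔥) :=
    (hfin.toFinset.biUnion fun b => E₀.image fun e => b e).filter fun e => e ∈ Q
  have hEmem : ∀ b ∈ S.parabolic (J \ Θ), ∀ e ∈ E₀, b e ∈ Q → b e ∈ E := by
    intro b hb e he hbe
    simp only [E, Finset.mem_filter, Finset.mem_biUnion, Set.Finite.mem_toFinset, Finset.mem_image]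
    exact ⟨⟨b, hb, e, he, rfl⟩, hbe⟩
  have hE₀Y : ∀ e ∈ E₀, e ∈ Y := fun e he => by
    have h1 : e ∈ Y ⊓ S.closedChamber := by
      rw [← hE₀]
      exact Submodule.subset_span he
    exact h1.1
  have hE : ∀ x ∈ Q, ∃ l ∈ Submodule.span ℝ (P : Set (Module.Dual ℝ 𝔥)),
      x + l ∈ PointedCone.hull ℝ (E : Set (Module.Dual ℝ 𝔥)) := by
    intro x hx
    obtain ⟨b, hb, hbx⟩ := hS.exists_parabolic_nonneg (J \ Θ) (hYX (hQY.le hx))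
    obtain ⟨N, hN, hNC, -⟩ := exists_smul_add_mem_closedChamber (y := b x) hμC fun j hj => by
      have hjJ : j ∈ J := by rw [← hJ]; exact hj
      by_cases hjΘ : j ∈ Θ
      · rw [hinv b hb j hjΘ, mem_upsilonLower_iff.1 (hΘQ hjΘ) x hx]
      · exact hbx j ⟨hjJ, hjΘ⟩
    have hbμ : b μ = μ := S.parabolic_apply_eq_self hb fun j hj => by
      have h1 := hj.1
      rw [← hJ] at h1
      exact h1
    have hxN : x + N • μ ∈ Q := Q.add_mem hx (PointedCone.smul_mem Q hN.le (hPQ hμ.1))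
    have hbxN : b (x + N • μ) ∈ Y ⊓ S.closedChamber := by
      refine ⟨hYW b (hW b hb) _ (hQY.le hxN), ?_⟩
      rw [map_add, map_smul, hbμ, add_comm]
      exact hNC
    rw [← hE₀] at hbxN
    obtain ⟨a, ha0, ha⟩ := PointedCone.mem_hull_finset.1 hbxN
    have hb' := inv_mem hb
    have hsum : ∑ e : E₀, a e • b⁻¹ (e : Module.Dual ℝ 𝔥) = x + N • μ := by
      rw [Finset.sum_coe_sort E₀ fun e => a e • b⁻¹ e]
      have h1 : b⁻¹ (b (x + N • μ)) = x + N • μ := b.symm_apply_apply _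
      rw [← h1, ← ha, map_sum]
      simp only [map_smul]
    refine ⟨N • μ, Submodule.smul_mem _ _ (Submodule.subset_span hμ.1), ?_⟩
    rw [← hsum]
    refine sum_mem fun e _ => ?_
    rcases (ha0 e).eq_or_lt with h0 | hpos
    · rw [← h0, zero_smul]
      exact zero_mem _
    · refine PointedCone.smul_mem _ (ha0 e) (PointedCone.subset_hull (hEmem _ hb' e e.2 ?_))
      -- A generator with positive coefficient in a sum lying in the face `Q` belongs to `Q`, hence
      -- to `E`.
      exact hQY.mem_of_sum_smul_mem (f := fun e : E₀ => b⁻¹ (e : Module.Dual ℝ 𝔥))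
        (c := fun e => a e) (fun e => hYW _ (hW _ hb') _ (hE₀Y e e.2)) (fun e => ha0 e)
        (hsum ▸ hxN) e hpos
  obtain ⟨R, hR, hPR, hdim⟩ := exists_face_coneDim_eq_succ hPQ' hne E
    (fun e he => (Finset.mem_filter.1 he).2) hE
  exact ⟨R, hR.trans hQY, hPR, hR.le, hdim⟩

end RayFamily

/-! ### Decomposition of the face lattice and passage from the cross section to all faces -/

namespace RayFamily

variable {I 𝔥 : Type*} [AddCommGroup 𝔥] [Module ℝ 𝔥] {S : RayFamily I 𝔥}
  {Y R R₁ R₂ : PointedCone ℝ (Module.Dual ℝ 𝔥)} {Θ : Set I} [Fintype I] [FiniteDimensional ℝ 𝔥]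

theorem existsUnique_facePart (hS : S.IsLinearCoxeterSystem)
    (hYX : (Y : Set (Module.Dual ℝ 𝔥)) ⊆ S.titsCone)
    (hYW : ∀ w ∈ S.weylGroup, ∀ μ ∈ Y, w μ ∈ Y) (hR : R ∈ faceSet Y) :
    ∃! Θ : Set I, S.IsSpecialFacial Θ ∧ R ∈ S.facePart Y Θ := by
  obtain ⟨w, hw, hwR⟩ := exists_weylGroup_map_mem_crossSection hYX hYW hR
  obtain ⟨μ, -, hμC, hJ⟩ := exists_isInner_zeroSet hS hYX hYW hwR
  refine ⟨_, ⟨hJ ▸ isSpecialFacial_infPart hμC, mem_facePart_iff.2 ⟨w, hw, hwR, rfl⟩⟩, ?_⟩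
  rintro Θ ⟨-, hΘ⟩
  exact (map_mem_crossSectionPart hS hYW hΘ hw hwR).2.symm

theorem exists_map_mem_crossSectionPart_pair (hS : S.IsLinearCoxeterSystem)
    (hYX : (Y : Set (Module.Dual ℝ 𝔥)) ⊆ S.titsCone)
    (hYW : ∀ w ∈ S.weylGroup, ∀ μ ∈ Y, w μ ∈ Y) (h₁ : R₁ ∈ S.facePart Y Θ)
    (h₂ : R₂ ∈ S.facePart Y Θ) (h : R₁ ≤ R₂) :
    ∃ w ∈ S.weylGroup,
      R₁.map (w : Module.Dual ℝ 𝔥 →ₗ[ℝ] Module.Dual ℝ 𝔥) ∈ S.crossSectionPart Y Θ ∧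
      R₂.map (w : Module.Dual ℝ 𝔥 →ₗ[ℝ] Module.Dual ℝ 𝔥) ∈ S.crossSectionPart Y Θ := by
  obtain ⟨w, hw, hw₁⟩ := mem_facePart_iff.1 h₁
  obtain ⟨v, hv, hv₂⟩ := exists_map_mem_crossSection hS hYX hYW hw₁.1
    (S.isFaceOf_map hYW (facePart_subset hYW h₂) hw) ((PointedCone.map_equiv_le_map_iff w).2 h)
  have hvw := mul_mem (S.parabolic_le _ hv) hw
  rw [← PointedCone.map_equiv_mul] at hv₂
  refine ⟨v * w, hvw, ?_, map_mem_crossSectionPart hS hYW h₂ hvw hv₂⟩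
  rwa [PointedCone.map_equiv_mul, map_eq_of_mem_parabolic_upsilonLower hv]

theorem mem_facePart_of_between (hS : S.IsLinearCoxeterSystem)
    (hYX : (Y : Set (Module.Dual ℝ 𝔥)) ⊆ S.titsCone)
    (hYW : ∀ w ∈ S.weylGroup, ∀ μ ∈ Y, w μ ∈ Y) (h₁ : R₁ ∈ S.facePart Y Θ)
    (h₂ : R₂ ∈ S.facePart Y Θ) (hR : R.IsFaceOf Y) (h₁R : R₁ ≤ R) (hR₂ : R ≤ R₂) :
    R ∈ S.facePart Y Θ := by
  obtain ⟨w, hw, hw₁, hw₂⟩ :=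
    exists_map_mem_crossSectionPart_pair hS hYX hYW h₁ h₂ (h₁R.trans hR₂)
  obtain ⟨v, hv, hvR, -⟩ := exists_map_mem_crossSectionPart hS hYX hYW hw₁ hw₂
    (S.isFaceOf_map hYW hR hw) ((PointedCone.map_equiv_le_map_iff w).2 h₁R)
    ((PointedCone.map_equiv_le_map_iff w).2 hR₂)
  rw [← PointedCone.map_equiv_mul] at hvR
  exact mem_facePart_iff.2 ⟨v * w, mul_mem hv hw, hvR⟩

theorem exists_covering_face_of_facePart (hS : S.IsLinearCoxeterSystem)
    (hYX : (Y : Set (Module.Dual ℝ 𝔥)) ⊆ S.titsCone)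
    (hYW : ∀ w ∈ S.weylGroup, ∀ μ ∈ Y, w μ ∈ Y) (hYfg : (Y ⊓ S.closedChamber).FG)
    (h₁ : R₁ ∈ S.facePart Y Θ) (h₂ : R₂ ∈ S.facePart Y Θ) (h : R₁ ≤ R₂) (hne : R₁ ≠ R₂) :
    ∃ R : PointedCone ℝ (Module.Dual ℝ 𝔥), R.IsFaceOf Y ∧ R₁ ≤ R ∧ R ≤ R₂ ∧
      coneDim R = coneDim R₁ + 1 := by
  obtain ⟨w, hw, hw₁, hw₂⟩ := exists_map_mem_crossSectionPart_pair hS hYX hYW h₁ h₂ h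
  obtain ⟨R, hR, h₁R, hR₂, hdim⟩ := exists_covering_face hS hYX hYW hYfg hw₁ hw₂
    ((PointedCone.map_equiv_le_map_iff w).2 h) (fun he => hne (le_antisymm h
      ((PointedCone.map_equiv_le_map_iff w).1 he.ge)))
  refine ⟨_, S.isFaceOf_map hYW hR (inv_mem hw), ?_, ?_, ?_⟩
  · have := (PointedCone.map_equiv_le_map_iff w⁻¹).2 h₁R
    rwa [PointedCone.map_inv_map] at this
  · have := (PointedCone.map_equiv_le_map_iff w⁻¹).2 hR₂
    rwa [PointedCone.map_inv_map] at this
  · rw [coneDim_map, hdim, coneDim_map]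

/-- Pointwise fixing climbs from `R₁` to `R₂`: a face one dimension above `R₁` is moved within the
interval into `Υ(Θ)`, where the reflection stabilizes it by assumption and hence fixes it pointwise.
-/
theorem mem_upsilonLower_of_forall_mem_upsilon (hS : S.IsLinearCoxeterSystem)
    (hYX : (Y : Set (Module.Dual ℝ 𝔥)) ⊆ S.titsCone)
    (hYW : ∀ w ∈ S.weylGroup, ∀ μ ∈ Y, w μ ∈ Y) (hYfg : (Y ⊓ S.closedChamber).FG)
    (h₁ : R₁ ∈ S.crossSectionPart Y Θ) (h₂ : R₂ ∈ S.crossSectionPart Y Θ) (h : R₁ ≤ R₂) {i : I}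
    (hi : ∀ R ∈ S.crossSectionPart Y Θ, R₁ ≤ R → R ≤ R₂ → i ∈ S.upsilon R)
    (hi₁ : i ∈ S.upsilonLower R₁) : i ∈ S.upsilonLower R₂ := by
  induction hn : coneDim R₂ - coneDim R₁ using Nat.strong_induction_on generalizing R₁ with
  | _ n ih =>
  by_cases hne : R₁ = R₂
  · exact hne ▸ hi₁
  obtain ⟨Q, hQ, h₁Q, hQ₂, hdim⟩ := exists_covering_face hS hYX hYW hYfg h₁ h₂ h hne
  obtain ⟨v, hv, hvQ, h₁vQ, hvQ₂⟩ :=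
    exists_map_mem_crossSectionPart hS hYX hYW h₁ h₂ hQ h₁Q hQ₂
  have hdim' := coneDim_map Q v
  have hlt := coneDim_lt_of_isFaceOf ((h₁.1.1.isFaceOf_iff_le h₂.1.1).2 h) hne
  refine ih _ ?_ hvQ hvQ₂ (fun R hR hR₁ hR₂ => hi R hR (h₁vQ.trans hR₁) hR₂) ?_ rfl
  · omega
  · exact mem_upsilonLower_of_coneDim_eq_succ ((h₁.1.1.isFaceOf_iff_le hvQ.1.1).2 h₁vQ)
      (by omega) hi₁ (hi _ hvQ h₁vQ hvQ₂)

end RayFamily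

theorem mainTheorem8 {I 𝔥 : Type*} [Fintype I] [AddCommGroup 𝔥] [Module ℝ 𝔥]
    [FiniteDimensional ℝ 𝔥] (S : RayFamily I 𝔥) (hS : S.IsLinearCoxeterSystem)
    (Y : PointedCone ℝ (Module.Dual ℝ 𝔥))
    (hYX : (Y : Set (Module.Dual ℝ 𝔥)) ⊆ S.titsCone)
    (hYW : ∀ w ∈ S.weylGroup, ∀ μ ∈ Y, w μ ∈ Y)
    (hYfg : (Y ⊓ S.closedChamber).FG) :
    -- the `W`-invariant decomposition of the face lattice
    (∀ Θ : Set I, S.IsSpecialFacial Θ →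
      S.facePart Y Θ ⊆ faceSet Y ∧
      ∀ w ∈ S.weylGroup, ∀ R ∈ S.facePart Y Θ,
        R.map (w : Module.Dual ℝ 𝔥 →ₗ[ℝ] Module.Dual ℝ 𝔥) ∈ S.facePart Y Θ) ∧
    (∀ R ∈ faceSet Y, ∃! Θ : Set I, S.IsSpecialFacial Θ ∧ R ∈ S.facePart Y Θ) ∧
    -- the properties of the parts
    ∀ Θ : Set I, S.IsSpecialFacial Θ →
      (∀ R₁ ∈ S.facePart Y Θ, ∀ R₂ ∈ S.facePart Y Θ, R₁ ≤ R₂ →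
        ∀ c : Set (PointedCone ℝ (Module.Dual ℝ 𝔥)), IsMaxChainBetween Y R₁ R₂ c →
          c ⊆ S.facePart Y Θ ∧
          (∀ P ∈ c, ∀ Q ∈ c, P < Q → (∀ R ∈ c, ¬ (P < R ∧ R < Q)) →
            coneDim Q = coneDim P + 1) ∧
          c.Finite ∧ (c.ncard : ℤ) = (coneDim R₂ : ℤ) - (coneDim R₁ : ℤ) + 1) ∧
      (∀ R₁ ∈ S.crossSectionPart Y Θ, ∀ R₂ ∈ S.crossSectionPart Y Θ, R₁ ≤ R₂ →
        Disjoint (S.upsilonUpper R₁) (S.upsilonLower R₂) ∧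
        S.upsilonUpper R₁ ∪ S.upsilonLower R₂ =
          ⋂ R ∈ {R | R ∈ S.crossSectionPart Y Θ ∧ R₁ ≤ R ∧ R ≤ R₂}, S.upsilon R) := by
  refine ⟨fun Θ _ => ⟨RayFamily.facePart_subset hYW, fun w hw R hR =>
    RayFamily.map_mem_facePart hR hw⟩, fun R hR =>
    RayFamily.existsUnique_facePart hS hYX hYW hR, fun Θ _ => ⟨?_, ?_⟩⟩
  · intro R₁ h₁ R₂ h₂ h c hc
    have hbetween : ∀ R ∈ {R | R ∈ faceSet Y ∧ R₁ ≤ R ∧ R ≤ R₂}, R ∈ S.facePart Y Θ :=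
      fun R hR => RayFamily.mem_facePart_of_between hS hYX hYW h₁ h₂ hR.1 hR.2.1 hR.2.2
    refine ⟨fun R hR => hbetween R (hc.prop.1 hR), ?_⟩
    refine maximal_chain_graded (s := {R | R ∈ faceSet Y ∧ R₁ ≤ R ∧ R ≤ R₂})
      ⟨RayFamily.facePart_subset hYW h₁, le_rfl, h⟩
      ⟨RayFamily.facePart_subset hYW h₂, h, le_rfl⟩ (fun x hx => hx.2) coneDim ?_ ?_ hc
    · intro P hP Q hQ hPQ
      exact coneDim_lt_of_isFaceOf ((hP.1.isFaceOf_iff_le hQ.1).2 hPQ.le) hPQ.ne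
    · intro P hP Q hQ hPQ
      obtain ⟨R, hR, hPR, hRQ, hdim⟩ := RayFamily.exists_covering_face_of_facePart hS hYX hYW hYfg
        (hbetween P hP) (hbetween Q hQ) hPQ.le hPQ.ne
      exact ⟨R, ⟨hR, hP.2.1.trans hPR, hRQ.trans hQ.2.2⟩, hPR, hRQ, hdim⟩
  · intro R₁ h₁ R₂ h₂ h
    have hanti := RayFamily.upsilonLower_anti (S := S) h
    refine ⟨Set.disjoint_left.2 fun i hi hi' => hi.2 (hanti hi'), Set.Subset.antisymm ?_ ?_⟩
    · refine Set.subset_iInter₂ fun R hR => Set.union_subset ?_ ?_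
      · exact RayFamily.upsilonUpper_subset_upsilon hYW hR.1.1.1 hR.2.1
      · exact (RayFamily.upsilonLower_anti hR.2.2).trans RayFamily.upsilonLower_subset_upsilon
    · intro i hi
      have hi' : ∀ R ∈ S.crossSectionPart Y Θ, R₁ ≤ R → R ≤ R₂ → i ∈ S.upsilon R :=
        fun R hR hR₁ hR₂ => Set.mem_iInter₂.1 hi R ⟨hR, hR₁, hR₂⟩
      by_cases hi₁ : i ∈ S.upsilonLower R₁
      · exact Or.inr (RayFamily.mem_upsilonLower_of_forall_mem_upsilon hS hYX hYW hYfg h₁ h₂ h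
          hi' hi₁)
      · exact Or.inl ⟨hi' R₁ h₁ le_rfl h, hi₁⟩

end
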